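/- **Corollary 2 (Orthounimodality).** Let $d\ge 2$, let $\mathcal X=[a,b]=\{x\in\mathbb R^d: a\le x\le b \text{ componentwise}\}$ be a hyperrectangle with $a_i<b_i$ for all $i$, let $M>0$, and let $$\mathcal F=\{f:\ 0\le f(x)\le M\ \ \forall x\in\mathcal X,\ f\text{ is orthounimodal about } a \text{ on }\mathcal X\},$$ where $f$ is orthounimodal about $a$ on $\mathcal X$ if, for each coordinate $i$ and any fixed values of the other coordinates, $x_i\mapsto f(x)$ is non-decreasing for $x_i\le a_i$ and non-increasing for $x_i\ge a_i$ (within $\mathcal X$). Let $g$ be a probability density on $\mathcal X$ with $0<\inf_{\mathcal X}g\le\sup_{\mathcal X}g<\infty$, and put $\mathcal L=\{f/g: f\in\mathcal F\}$. Let $0\le m\le l$, let $\mu_1,\dots,\mu_l\in\mathbb R$, and let $\phi_0,\dots,\phi_l:\mathcal X\to\mathbb R$ be measurable with $\int_{\mathcal X}|\phi_j(x)|^{1+\delta}dx<\infty$, $j=0,\dots,l$, for some $\delta>0$. Consider $$(\mathcal P):\quad \sup_{L\in\mathcal L}\ \mathbb E_g[\phi_0(X)L(X)]\quad\text{s.t.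 } \mathbb E_g[\phi_j(X)L(X)]\le\mu_j\ (1\le j\le m),\quad \mathbb E_g[\phi_j(X)L(X)]=\mu_j\ (m<j\le l).$$ (The requirement that $f=Lg$ integrate to one is expressed, when wanted, by taking one of the equality constraints to be $\phi_j\equiv1$, $\mu_j=1$.) For i.i.d. samples $X_1,X_2,\dots$ from $g$ and $n\ge1$, the importance-weighted sample average approximation (IW-SAA) is $$(\mathcal P_n):\quad \sup_{L\in\mathcal L}\ \frac1n\sum_{i=1}^n\phi_0(X_i)L(X_i)\quad\text{s.t. } \frac1n\sum_{i=1}^n\phi_j(X_i)L(X_i)\le\mu_j\ (1\le j\le m),\quad \frac1n\sum_{i=1}^n\phi_j(X_i)L(X_i)=\mu_j\ (m<j\le l).$$ Assume the following Slater condition: there is $L_0\in\mathcal L$ with $\mathbb E_g[\phi_j(X)L_0(X)]<\mu_j$ for $1\le j\le m$ and $\mathbb E_g[\phi_j(X)L_0(X)]=\mu_j$ for $m<j\le l$; and $(\mu_{m+1},\dots,\mu_l)$ is an interior point of $\{(\mathbb E_g[\phi_{m+1}(X)L(X)],\dots,\mathbb E_g[\phi_l(X)L(X)]): L\in\mathcal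 L\}$. Then: 1. *(Finite-dimensional reduction.)* For every $n\ge1$ and all sample points $X_1,\dots,X_n\in\mathcal X$, the set $\{(L(X_1),\dots,L(X_n)): L\in\mathcal L\}$ equals the set of all $(L_1,\dots,L_n)\in\mathbb R^n$ satisfying the discrete shape constraint $$L_i\,g(X_i)\le L_j\,g(X_j)\ \text{ whenever } X_i\ge X_j \text{ componentwise},\qquad 0\le L_i\,g(X_i)\le M,\ i=1,\dots,n.$$ Consequently $(\mathcal P_n)$ is equivalent to the linear program $(\mathcal P_n')$ obtained from $(\mathcal P_n)$ by taking the numbers $L_i=L(X_i)$ as decision variables and replacing $L\in\mathcal L$ by this discrete constraint: the values at $X_1,\dots,X_n$ of the feasible functions of $(\mathcal P_n)$ are exactly the feasible points of $(\mathcal P_n')$, and the optimal values are equal. The samples lie in $\mathcal X$ almost surely. 2. *(Consistency.)* $|val(\mathcal P_n)-val(\mathcal P)|\to0$ outer almost surely, i.e. the minimal measurable majorants $|val(\mathcal P_n)-val(\mathcal P)|^*$ converge to $0$ almost surely. Here $val$ is the supremum in $[-\infty,\infty]$, equal to $-\infty$ for an infeasible problem. -/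

import Mathlib

open MeasureTheory ProbabilityTheory Filter Topology
open scoped ENNReal Matrix

noncomputable section

namespace IWSAA

/-- Optimal value, in the extended reals, of maximizing `obj` over the feasible set `S`
(it is `⊥ = -∞` when `S` is empty). -/
def optVal {α : Type*} (S : Set α) (obj : α → ℝ) : EReal :=
  ⨆ x ∈ S, (obj x : EReal)

/-- `f` is orthounimodal about the mode `c` on the set `S`: along every coordinate direction, the
other coordinates being fixed, it is non-decreasing up to `c i` and non-increasing after `c i`. -/
def IsOrthounimodalOn {d : ℕ} (f : (Fin d → ℝ) → ℝ) (c : Fin d → ℝ) (S : Set (Fin d → ℝ)) :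
    Prop :=
  ∀ (i : Fin d) (x : Fin d → ℝ),
    MonotoneOn (fun t : ℝ => f (Function.update x i t)) {t | t ≤ c i ∧ Function.update x i t ∈ S} ∧
    AntitoneOn (fun t : ℝ => f (Function.update x i t)) {t | c i ≤ t ∧ Function.update x i t ∈ S}

/-- The shape class: functions with values in `[0, M]` on the box `[a, b]`, orthounimodal about
the vertex `a` there. Only the values on the box matter. -/
def shapeClass {d : ℕ} (a b : Fin d → ℝ) (M : ℝ) : Set ((Fin d → ℝ) → ℝ) :=
  {f | (∀ x ∈ Set.Icc a b, 0 ≤ f x ∧ f x ≤ M) ∧ IsOrthounimodalOn f a (Set.Icc a b)}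

/-- The class of likelihood ratios `L = f / g` on the box, with `f` in the shape class. -/
def ratioClass {d : ℕ} (a b : Fin d → ℝ) (M : ℝ) (g : (Fin d → ℝ) → ℝ) :
    Set ((Fin d → ℝ) → ℝ) :=
  {L | ∃ f ∈ shapeClass a b M, ∀ x ∈ Set.Icc a b, L x = f x / g x}

/-- The distribution on the box `[a, b]` with Lebesgue density `g`. -/
def densityLaw {d : ℕ} (a b : Fin d → ℝ) (g : (Fin d → ℝ) → ℝ) : Measure (Fin d → ℝ) :=
  (volume.restrict (Set.Icc a b)).withDensity (fun x => ENNReal.ofReal (g x))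

/-- `E_g[φ(X) L(X)]`. -/
def popMoment {d : ℕ} (a b : Fin d → ℝ) (g φ L : (Fin d → ℝ) → ℝ) : ℝ :=
  ∫ x, φ x * L x ∂(densityLaw a b g)

/-- `(1/n) ∑ i, φ(x i) y i`, the sample analogue; the entry `y i` stands for `L (x i)`. -/
def sampleMoment {d n : ℕ} (x : Fin n → Fin d → ℝ) (φ : (Fin d → ℝ) → ℝ) (y : Fin n → ℝ) : ℝ :=
  (1 / (n : ℝ)) * ∑ i, φ (x i) * y i

/-- Feasible set of the population problem: `m` inequality and `k` equality moment constraints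
and the shape constraint. -/
def popFeasible {d m k : ℕ} (a b : Fin d → ℝ) (M : ℝ) (g : (Fin d → ℝ) → ℝ)
    (φ : Fin m → (Fin d → ℝ) → ℝ) (μ : Fin m → ℝ)
    (ψ : Fin k → (Fin d → ℝ) → ℝ) (ν : Fin k → ℝ) : Set ((Fin d → ℝ) → ℝ) :=
  {L | (∀ j, popMoment a b g (φ j) L ≤ μ j) ∧ (∀ j, popMoment a b g (ψ j) L = ν j) ∧
    L ∈ ratioClass a b M g}

/-- Optimal value of the population problem. -/
def popVal {d m k : ℕ} (a b : Fin d → ℝ) (M : ℝ) (g φ₀ : (Fin d → ℝ) → ℝ)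
    (φ : Fin m → (Fin d → ℝ) → ℝ) (μ : Fin m → ℝ)
    (ψ : Fin k → (Fin d → ℝ) → ℝ) (ν : Fin k → ℝ) : EReal :=
  optVal (popFeasible a b M g φ μ ψ ν) (fun L => popMoment a b g φ₀ L)

/-- Feasible set of the sample problem at the sample points `x`. The decision variable is still a
function in the likelihood ratio class. -/
def saaFeasible {d m k n : ℕ} (a b : Fin d → ℝ) (M : ℝ) (g : (Fin d → ℝ) → ℝ)
    (φ : Fin m → (Fin d → ℝ) → ℝ) (μ : Fin m → ℝ)
    (ψ : Fin k → (Fin d → ℝ) → ℝ) (ν : Fin k → ℝ) (x : Fin n → Fin d → ℝ) :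
    Set ((Fin d → ℝ) → ℝ) :=
  {L | (∀ j, sampleMoment x (φ j) (fun i => L (x i)) ≤ μ j) ∧
    (∀ j, sampleMoment x (ψ j) (fun i => L (x i)) = ν j) ∧ L ∈ ratioClass a b M g}

/-- Optimal value of the sample problem at the sample points `x`. -/
def saaVal {d m k n : ℕ} (a b : Fin d → ℝ) (M : ℝ) (g φ₀ : (Fin d → ℝ) → ℝ)
    (φ : Fin m → (Fin d → ℝ) → ℝ) (μ : Fin m → ℝ)
    (ψ : Fin k → (Fin d → ℝ) → ℝ) (ν : Fin k → ℝ) (x : Fin n → Fin d → ℝ) : EReal :=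
  optVal (saaFeasible a b M g φ μ ψ ν x) (fun L => sampleMoment x φ₀ (fun i => L (x i)))

/-- The discrete shape constraint on the values `y i = L (x i)`: pairwise constraints along the
componentwise order, and the bounds. -/
def discreteShape {d n : ℕ} (M : ℝ) (g : (Fin d → ℝ) → ℝ) (x : Fin n → Fin d → ℝ) :
    Set (Fin n → ℝ) :=
  {y | (∀ i j, x j ≤ x i → y i * g (x i) ≤ y j * g (x j)) ∧
    ∀ i, 0 ≤ y i * g (x i) ∧ y i * g (x i) ≤ M}

/-- Feasible set of the finite-dimensional problem. -/
def lpFeasible {d m k n : ℕ} (M : ℝ) (g : (Fin d → ℝ) → ℝ)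
    (φ : Fin m → (Fin d → ℝ) → ℝ) (μ : Fin m → ℝ)
    (ψ : Fin k → (Fin d → ℝ) → ℝ) (ν : Fin k → ℝ) (x : Fin n → Fin d → ℝ) : Set (Fin n → ℝ) :=
  {y | (∀ j, sampleMoment x (φ j) y ≤ μ j) ∧ (∀ j, sampleMoment x (ψ j) y = ν j) ∧
    y ∈ discreteShape M g x}

/-- Optimal value of the finite-dimensional problem. -/
def lpVal {d m k n : ℕ} (M : ℝ) (g φ₀ : (Fin d → ℝ) → ℝ)
    (φ : Fin m → (Fin d → ℝ) → ℝ) (μ : Fin m → ℝ)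
    (ψ : Fin k → (Fin d → ℝ) → ℝ) (ν : Fin k → ℝ) (x : Fin n → Fin d → ℝ) : EReal :=
  optVal (lpFeasible M g φ μ ψ ν x) (fun y => sampleMoment x φ₀ y)

/-- Optimizing `obj` over `S` is a linear program in `n` real variables: the objective is linear
and `S` is cut out by finitely many linear inequalities and equations. -/
def IsLinearProgram {n : ℕ} (S : Set (Fin n → ℝ)) (obj : (Fin n → ℝ) → ℝ) : Prop :=
  (∃ c : Fin n → ℝ, ∀ y, obj y = c ⬝ᵥ y) ∧
  ∃ (p q : ℕ) (A : Matrix (Fin p) (Fin n) ℝ) (u : Fin p → ℝ)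
    (B : Matrix (Fin q) (Fin n) ℝ) (v : Fin q → ℝ), S = {y | A *ᵥ y ≤ u ∧ B *ᵥ y = v}

/-- The Slater condition: a feasible function that is strict in the inequality constraints, and
the right-hand side of the equality constraints is interior to the set of attainable moments. -/
def SlaterCondition {d m k : ℕ} (a b : Fin d → ℝ) (M : ℝ) (g : (Fin d → ℝ) → ℝ)
    (φ : Fin m → (Fin d → ℝ) → ℝ) (μ : Fin m → ℝ)
    (ψ : Fin k → (Fin d → ℝ) → ℝ) (ν : Fin k → ℝ) : Prop :=
  (∃ L₀ ∈ ratioClass a b M g, (∀ j, popMoment a b g (φ j) L₀ < μ j) ∧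
    ∀ j, popMoment a b g (ψ j) L₀ = ν j) ∧
  ν ∈ interior ((fun (L : (Fin d → ℝ) → ℝ) (j : Fin k) => popMoment a b g (ψ j) L) ''
    ratioClass a b M g)

/-- `U` is a minimal measurable majorant of the (arbitrary) map `T`. -/
def IsMinimalMeasurableMajorant {Ω : Type*} [MeasurableSpace Ω] (P : Measure Ω)
    (T U : Ω → ℝ≥0∞) : Prop :=
  Measurable U ∧ (∀ ω, T ω ≤ U ω) ∧
    ∀ V : Ω → ℝ≥0∞, Measurable V → (∀ᵐ ω ∂P, T ω ≤ V ω) → ∀ᵐ ω ∂P, U ω ≤ V ω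

/-- Outer almost sure convergence of arbitrary extended real valued maps: the minimal measurable
majorants of `|Z n - z|` tend to zero almost surely. An undefined difference `∞ - ∞` has
`EReal.abs` equal to `∞`. -/
def TendstoOuterAS {Ω : Type*} [MeasurableSpace Ω] (P : Measure Ω)
    (Z : ℕ → Ω → EReal) (z : Ω → EReal) : Prop :=
  ∃ U : ℕ → Ω → ℝ≥0∞,
    (∀ n, IsMinimalMeasurableMajorant P (fun ω => (Z n ω - z ω).abs) (U n)) ∧
    ∀ᵐ ω ∂P, Tendsto (fun n => U n ω) atTop (𝓝 0)

end IWSAA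

end

namespace IWSAA

/-! ### The shape class consists of the bounded antitone functions -/

/-! Since the mode is the least vertex of the box, orthounimodality there is plain antitonicity for
the componentwise order (`mem_shapeClass_iff`). The reduction is then an extension problem: data
that are antitone on finitely many points extend to the box by a maximum over the sample points
above the argument (`image_ratioClass`).

Consistency combines a uniform law of large numbers with a deterministic stability estimate. For the
first, put `1 / g` into the weight `w = φ / g` and cut the box into `N ^ d` cells. An antitone `f`
differs from its step function by at most its oscillation on each cell. Along each diagonal these
oscillations telescope, so they sum to `O(N ^ (d - 1))`, while a cell has mass `O(N ^ (-d))`. Hence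
the mean oscillation is uniformly small, after truncation even for a weight that is merely
integrable (`exists_sum_oscillation_le`). What remains is the strong law for finitely many cells
(`exists_uniform_deviation_bound`).

For the second, both problems depend on the likelihood ratios only through a convex set of moment
vectors in finite dimension. The Slater condition puts a ball around the right-hand side into the
attainable ones (`exists_ball_subset_attainable`). By Hahn-Banach a slightly smaller ball is
attainable for any convex set uniformly close to the first, and mixing with an over-corrected point
repairs small constraint violations at proportional cost. So the value is Lipschitz in the uniform
deviation (`abs_optVal_sub_le`). The resulting bound is measurable and therefore dominates the
minimal measurable majorants almost surely, although the sample value itself need not be measurable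
(`tendstoOuterAS_of_le`). -/

/-- Move from `x` to `y` one coordinate at a time. All intermediate points stay in the box, where
every coordinate is at least `a i`, so only the non-increasing half is needed. -/
theorem antitoneOn_of_isOrthounimodalOn {d : ℕ} {a b : Fin d → ℝ} {f : (Fin d → ℝ) → ℝ}
    (hf : IsOrthounimodalOn f a (Set.Icc a b)) : AntitoneOn f (Set.Icc a b) := by
  intro x hx y hy hxy
  have key : ∀ s : Finset (Fin d), f (s.piecewise y x) ≤ f x := by
    intro s
    induction s using Finset.induction_on with
    | empty => simp
    | insert i s hi ih =>
      refine le_trans ?_ ih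
      have hbox : ∀ t : Finset (Fin d), t.piecewise y x ∈ Set.Icc a b := by
        intro t
        refine ⟨fun j => ?_, fun j => ?_⟩ <;> by_cases hj : j ∈ t <;>
          simp [hj, hx.1 j, hx.2 j, hy.1 j, hy.2 j]
      have h1 : Function.update (s.piecewise y x) i (x i) = s.piecewise y x := by
        rw [Function.update_eq_self_iff]; simp [hi]
      have h2 : Function.update (s.piecewise y x) i (y i) = (insert i s).piecewise y x :=
        (Finset.piecewise_insert _ _ _ _).symm
      have := (hf i (s.piecewise y x)).2
        (show x i ∈ {t | _} from ⟨hx.1 i, by rw [h1]; exact hbox _⟩)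
        (show y i ∈ {t | _} from ⟨hy.1 i, by rw [h2]; exact hbox _⟩) (hxy i)
      simpa only [h1, h2] using this
  simpa using key Finset.univ

/-- The non-decreasing half is vacuous: inside the box, `t ≤ a i` forces `t = a i`. -/
theorem isOrthounimodalOn_of_antitoneOn {d : ℕ} {a b : Fin d → ℝ} {f : (Fin d → ℝ) → ℝ}
    (hf : AntitoneOn f (Set.Icc a b)) : IsOrthounimodalOn f a (Set.Icc a b) := by
  intro i x
  constructor
  · rintro s ⟨hs, hs'⟩ t ⟨ht, ht'⟩ -
    have h1 : a i ≤ s := by simpa using hs'.1 i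
    have h2 : a i ≤ t := by simpa using ht'.1 i
    rw [le_antisymm hs h1, le_antisymm ht h2]
  · rintro s ⟨-, hs'⟩ t ⟨-, ht'⟩ hst
    exact hf hs' ht' (Function.update_mono hst)

theorem mem_shapeClass_iff {d : ℕ} {a b : Fin d → ℝ} {M : ℝ} {f : (Fin d → ℝ) → ℝ} :
    f ∈ shapeClass a b M ↔
      (∀ x ∈ Set.Icc a b, 0 ≤ f x ∧ f x ≤ M) ∧ AntitoneOn f (Set.Icc a b) :=
  ⟨fun h => ⟨h.1, antitoneOn_of_isOrthounimodalOn h.2⟩,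
    fun h => ⟨h.1, isOrthounimodalOn_of_antitoneOn h.2⟩⟩

/-! ### The finite-dimensional reduction -/

theorem image_ratioClass {d n : ℕ} (hn : 0 < n) {a b : Fin d → ℝ} {M : ℝ} (hM : 0 ≤ M)
    {g : (Fin d → ℝ) → ℝ} (hg : ∀ x ∈ Set.Icc a b, 0 < g x)
    (x : Fin n → Fin d → ℝ) (hx : ∀ i, x i ∈ Set.Icc a b) :
    (fun (L : (Fin d → ℝ) → ℝ) (i : Fin n) => L (x i)) '' ratioClass a b M g
      = discreteShape M g x := by
  ext y
  constructor
  · rintro ⟨L, ⟨f, hf, hL⟩, rfl⟩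
    have hf' := mem_shapeClass_iff.1 hf
    have e : ∀ i, L (x i) * g (x i) = f (x i) := fun i => by
      rw [hL _ (hx i), div_mul_cancel₀ _ (hg _ (hx i)).ne']
    refine ⟨fun i j hij => ?_, fun i => ?_⟩
    · simp only [e]; exact hf'.2 (hx j) (hx i) hij
    · simp only [e]; exact hf'.1 _ (hx i)
  · rintro ⟨h1, h2⟩
    have : Nonempty (Fin n) := ⟨⟨0, hn⟩⟩
    classical
    -- The supremum of `F z` over `i` is the smallest nonnegative antitone extension of the data:
    -- the largest prescribed value at a sample point above `z`, and `0` if there is none.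
    set F : (Fin d → ℝ) → Fin n → ℝ := fun z i => if z ≤ x i then y i * g (x i) else 0 with hF
    have hF0 : ∀ z i, 0 ≤ F z i ∧ F z i ≤ M := fun z i => by
      simp only [hF]; split_ifs
      · exact h2 i
      · exact ⟨le_rfl, hM⟩
    have hbdd : ∀ z, BddAbove (Set.range (F z)) := fun z => Set.finite_range _ |>.bddAbove
    set f : (Fin d → ℝ) → ℝ := fun z => ⨆ i, F z i with hf
    refine ⟨fun z => f z / g z, ⟨f, mem_shapeClass_iff.2 ⟨fun z _ => ⟨?_, ?_⟩, ?_⟩, fun _ _ => rfl⟩,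
      ?_⟩
    · exact Real.iSup_nonneg fun i => (hF0 z i).1
    · exact ciSup_le fun i => (hF0 z i).2
    · intro z _ w _ hzw
      refine ciSup_mono (hbdd z) fun i => ?_
      by_cases hw : w ≤ x i
      · simp [hF, hw, hzw.trans hw]
      · simpa [hF, hw] using (hF0 z i).1
    · funext j
      have : f (x j) = y j * g (x j) := by
        apply le_antisymm
        · refine ciSup_le fun i => ?_
          simp only [hF]; split_ifs with h
          · exact h1 i j h
          · exact (h2 j).1
        · exact le_trans (by simp [hF]) (le_ciSup (hbdd (x j)) j)
      simp only [this]
      rw [mul_div_cancel_right₀ _ (hg _ (hx j)).ne']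

theorem image_saaFeasible {d m k n : ℕ} (hn : 0 < n) {a b : Fin d → ℝ} {M : ℝ} (hM : 0 ≤ M)
    {g : (Fin d → ℝ) → ℝ} (hg : ∀ x ∈ Set.Icc a b, 0 < g x)
    (φ : Fin m → (Fin d → ℝ) → ℝ) (μ : Fin m → ℝ) (ψ : Fin k → (Fin d → ℝ) → ℝ) (ν : Fin k → ℝ)
    (x : Fin n → Fin d → ℝ) (hx : ∀ i, x i ∈ Set.Icc a b) :
    (fun (L : (Fin d → ℝ) → ℝ) (i : Fin n) => L (x i)) '' saaFeasible a b M g φ μ ψ ν x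
      = lpFeasible M g φ μ ψ ν x := by
  ext y
  constructor
  · rintro ⟨L, ⟨h1, h2, h3⟩, rfl⟩
    exact ⟨h1, h2, (image_ratioClass hn hM hg x hx).subset ⟨L, h3, rfl⟩⟩
  · rintro ⟨h1, h2, h3⟩
    obtain ⟨L, hL, rfl⟩ := (image_ratioClass hn hM hg x hx).superset h3
    exact ⟨L, ⟨h1, h2, hL⟩, rfl⟩

theorem optVal_image {α β : Type*} (T : α → β) (S : Set α) (obj : β → ℝ) :
    optVal (T '' S) obj = optVal S (fun x => obj (T x)) :=
  iSup_image

theorem saaVal_eq_lpVal {d m k n : ℕ} (hn : 0 < n) {a b : Fin d → ℝ} {M : ℝ} (hM : 0 ≤ M)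
    {g : (Fin d → ℝ) → ℝ} (hg : ∀ x ∈ Set.Icc a b, 0 < g x) (φ₀ : (Fin d → ℝ) → ℝ)
    (φ : Fin m → (Fin d → ℝ) → ℝ) (μ : Fin m → ℝ) (ψ : Fin k → (Fin d → ℝ) → ℝ) (ν : Fin k → ℝ)
    (x : Fin n → Fin d → ℝ) (hx : ∀ i, x i ∈ Set.Icc a b) :
    saaVal a b M g φ₀ φ μ ψ ν x = lpVal M g φ₀ φ μ ψ ν x := by
  rw [lpVal, ← image_saaFeasible hn hM hg φ μ ψ ν x hx, optVal_image, saaVal]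

theorem exists_matrix_le {n : ℕ} {ι : Type*} [Fintype ι] (A : ι → Fin n → ℝ) (u : ι → ℝ) :
    ∃ (p : ℕ) (A' : Matrix (Fin p) (Fin n) ℝ) (u' : Fin p → ℝ),
      ∀ y : Fin n → ℝ, A' *ᵥ y ≤ u' ↔ ∀ r, A r ⬝ᵥ y ≤ u r := by
  refine ⟨Fintype.card ι, fun r => A ((Fintype.equivFin ι).symm r),
    fun r => u ((Fintype.equivFin ι).symm r), fun y => ?_⟩
  exact ((Fintype.equivFin ι).symm.forall_congr_left (p := fun r => A _ ⬝ᵥ y ≤ u _)).trans (by simp)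

theorem sampleMoment_eq_dotProduct {d n : ℕ} (x : Fin n → Fin d → ℝ) (φ : (Fin d → ℝ) → ℝ)
    (y : Fin n → ℝ) :
    sampleMoment x φ y = (fun i => (1 / (n : ℝ)) * φ (x i)) ⬝ᵥ y := by
  simp [sampleMoment, dotProduct, Finset.mul_sum, mul_assoc]

theorem isLinearProgram_lpFeasible {d m k n : ℕ} (M : ℝ) (g φ₀ : (Fin d → ℝ) → ℝ)
    (φ : Fin m → (Fin d → ℝ) → ℝ) (μ : Fin m → ℝ) (ψ : Fin k → (Fin d → ℝ) → ℝ) (ν : Fin k → ℝ)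
    (x : Fin n → Fin d → ℝ) :
    IsLinearProgram (lpFeasible M g φ μ ψ ν x) (fun y => sampleMoment x φ₀ y) := by
  classical
  refine ⟨⟨_, fun y => sampleMoment_eq_dotProduct x φ₀ y⟩, ?_⟩
  -- One block of rows each for the inequality moments, the order constraints, the lower bounds and
  -- the upper bounds.
  let A : Fin m ⊕ {r : Fin n × Fin n // x r.2 ≤ x r.1} ⊕ Fin n ⊕ Fin n → Fin n → ℝ :=
    Sum.elim (fun j i => (1 / (n : ℝ)) * φ j (x i))
      (Sum.elim (fun r => Pi.single r.1.1 (g (x r.1.1)) - Pi.single r.1.2 (g (x r.1.2)))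
        (Sum.elim (fun i => - Pi.single i (g (x i))) (fun i => Pi.single i (g (x i)))))
  let u : Fin m ⊕ {r : Fin n × Fin n // x r.2 ≤ x r.1} ⊕ Fin n ⊕ Fin n → ℝ :=
    Sum.elim μ (Sum.elim (fun _ => 0) (Sum.elim (fun _ => 0) (fun _ => M)))
  obtain ⟨p, A', u', h⟩ := exists_matrix_le A u
  refine ⟨p, k, A', u', fun j i => (1 / (n : ℝ)) * ψ j (x i), ν, ?_⟩
  ext y
  have hB : (Matrix.mulVec (fun j i => (1 / (n : ℝ)) * ψ j (x i)) y = ν) ↔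
      ∀ j, sampleMoment x (ψ j) y = ν j := by
    simp only [sampleMoment_eq_dotProduct]; exact funext_iff
  simp only [Set.mem_ofPred_eq, h, hB, lpFeasible, discreteShape]
  simp only [A, u, Sum.forall, Sum.elim_inl, Sum.elim_inr, sub_dotProduct, neg_dotProduct,
    single_dotProduct, Subtype.forall, Prod.forall, ← sampleMoment_eq_dotProduct, sub_nonpos,
    neg_nonpos, mul_comm (g _), forall_and]
  tauto

/-! ### Minimal measurable majorants -/

/-- Take measurable hulls of the superlevel sets at rational levels and rebuild a function from
them. It is minimal because a hull meets any measurable set, here `{V < q}`, in the same measure as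
the original set does. -/
theorem exists_isMinimalMeasurableMajorant {Ω : Type*} [MeasurableSpace Ω] (P : Measure Ω)
    [IsFiniteMeasure P] (T : Ω → ℝ≥0∞) : ∃ U, IsMinimalMeasurableMajorant P T U := by
  let B : ℚ → Set Ω := fun q => toMeasurable P {ω | (Real.toNNReal q : ℝ≥0∞) < T ω}
  have hB : ∀ q, MeasurableSet (B q) := fun q => measurableSet_toMeasurable _ _
  refine ⟨fun ω => ⨆ q : ℚ, (B q).indicator (fun _ => (Real.toNNReal q : ℝ≥0∞)) ω,
    Measurable.iSup fun q => measurable_const.indicator (hB q), fun ω => ?_, fun V hV hTV => ?_⟩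
  · refine le_of_forall_lt fun c hc => ?_
    obtain ⟨q, -, hq1, hq2⟩ := ENNReal.lt_iff_exists_rat_btwn.1 hc
    refine hq1.trans_le (le_trans ?_ (le_iSup _ q))
    rw [Set.indicator_of_mem]
    exact subset_toMeasurable _ _ hq2
  · have key : ∀ q : ℚ, ∀ᵐ ω ∂P, ω ∈ B q → (Real.toNNReal q : ℝ≥0∞) ≤ V ω := by
      intro q
      have hS : MeasurableSet {ω | V ω < (Real.toNNReal q : ℝ≥0∞)} :=
        measurableSet_lt hV measurable_const
      have h1 := Measure.measure_toMeasurable_inter (μ := P) hS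
        (measure_ne_top P {ω | (Real.toNNReal q : ℝ≥0∞) < T ω})
      have h2 : P ({ω | (Real.toNNReal q : ℝ≥0∞) < T ω} ∩ {ω | V ω < (Real.toNNReal q : ℝ≥0∞)}) = 0 := by
        refine measure_mono_null ?_ hTV
        rintro ω ⟨h3, h4⟩ h5
        exact (lt_of_lt_of_le (Set.mem_ofPred_eq.mp h3) h5).asymm (Set.mem_ofPred_eq.mp h4)
      rw [h2] at h1
      have h6 := measure_eq_zero_iff_ae_notMem.1 h1
      filter_upwards [h6] with ω hω hωB
      by_contra hlt
      exact hω ⟨hωB, not_le.1 hlt⟩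
    filter_upwards [ae_all_iff.2 key] with ω hω
    refine iSup_le fun q => ?_
    by_cases hq : ω ∈ B q
    · rw [Set.indicator_of_mem hq]; exact hω q hq
    · rw [Set.indicator_of_notMem hq]; exact zero_le

/-- Outer almost sure convergence follows from an almost sure bound by measurable maps that
converge to zero almost surely. -/
theorem tendstoOuterAS_of_le {Ω : Type*} [MeasurableSpace Ω] {P : Measure Ω}
    [IsFiniteMeasure P] {Z : ℕ → Ω → EReal} {z : Ω → EReal} (V : ℕ → Ω → ℝ≥0∞)
    (hV : ∀ n, Measurable (V n))
    (hle : ∀ᶠ n in atTop, ∀ᵐ ω ∂P, (Z n ω - z ω).abs ≤ V n ω)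
    (hlim : ∀ᵐ ω ∂P, Tendsto (fun n => V n ω) atTop (𝓝 0)) : TendstoOuterAS P Z z := by
  choose U hU using fun n => exists_isMinimalMeasurableMajorant P (fun ω => (Z n ω - z ω).abs)
  refine ⟨U, hU, ?_⟩
  obtain ⟨N, hN⟩ := eventually_atTop.1 hle
  have h : ∀ᵐ ω ∂P, ∀ n, N ≤ n → U n ω ≤ V n ω :=
    by
    refine ae_all_iff.2 fun n => ?_
    by_cases hn : N ≤ n
    · filter_upwards [(hU n).2.2 _ (hV n) (hN n hn)] with ω hω _ using hω
    · exact Eventually.of_forall fun ω h => absurd h hn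
  filter_upwards [h, hlim] with ω h1 h2
  exact tendsto_of_tendsto_of_tendsto_of_le_of_le' tendsto_const_nhds h2
    (Eventually.of_forall fun _ => zero_le) (eventually_atTop.2 ⟨N, h1⟩)

end IWSAA

namespace IWSAA

/-! ### Convex sets close to one another, and perturbation of optimal values -/

/-- Affine subspaces are closed in finite dimension, so `A` spans the whole space and has an
interior point `y`. Prolong the segment from `y` to `x` slightly beyond `x`, still in the closure.
Then `x` lies strictly between an interior point and a closure point. -/
theorem interior_closure_subset_of_convex {E : Type*} [NormedAddCommGroup E] [NormedSpace ℝ E]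
    [FiniteDimensional ℝ E] {A : Set E} (hA : Convex ℝ A) : interior (closure A) ⊆ A := by
  intro x hx
  have hspan : affineSpan ℝ A = ⊤ := by
    have h1 : affineSpan ℝ (closure A) = ⊤ :=
      hA.closure.interior_nonempty_iff_affineSpan_eq_top.1 ⟨x, hx⟩
    have h2 : closure A ⊆ affineSpan ℝ A :=
      closure_minimal (subset_affineSpan ℝ A) (AffineSubspace.closed_of_finiteDimensional _)
    exact top_le_iff.1 (h1 ▸ affineSpan_le.2 h2)
  obtain ⟨y, hy⟩ := hA.interior_nonempty_iff_affineSpan_eq_top.2 hspan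
  have hcont : ContinuousAt (fun t : ℝ => x + t • (x - y)) 0 := by fun_prop
  have hmem : ∀ᶠ t : ℝ in 𝓝 0, x + t • (x - y) ∈ closure A :=
    hcont.eventually_mem (by simpa using mem_interior_iff_mem_nhds.1 hx)
  obtain ⟨t, ht, ht0⟩ := ((hmem.filter_mono nhdsWithin_le_nhds).and
    (self_mem_nhdsWithin (s := Set.Ioi (0 : ℝ)))).exists
  have ht0 : 0 < t := ht0
  have := hA.combo_interior_closure_mem_interior hy ht (a := t / (1 + t)) (b := 1 / (1 + t))
    (by positivity) (by positivity) (by field_simp; ring)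
  refine interior_subset ?_
  convert this using 1
  have h1 : (1 + t) ≠ 0 := by positivity
  have : x = (1 / (1 + t)) • ((1 + t) • x) := by rw [smul_smul]; field_simp; simp
  conv_lhs => rw [this]
  rw [div_eq_mul_one_div t, mul_comm t, mul_smul, ← smul_add]
  congr 1
  module

/-- If `w` were outside the closure of `A`, a functional `l` would separate it. Push `w` by the
vector `v` of norm at most `ε` on which `l` is largest: no point within `ε` of `w + v` can have an
`l`-value below `l w`, so none lies in `A`. -/
theorem ball_subset_of_convex_of_approx {E : Type*} [NormedAddCommGroup E] [NormedSpace ℝ E]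
    [FiniteDimensional ℝ E] {A : Set E} (hA : Convex ℝ A) {x : E} {ρ ε : ℝ} (hε : 0 ≤ ε)
    (h : ∀ y ∈ Metric.ball x ρ, ∃ a ∈ A, ‖y - a‖ ≤ ε) :
    Metric.ball x (ρ - ε) ⊆ A := by
  refine (interior_maximal (fun w hw => ?_) Metric.isOpen_ball).trans
    (interior_closure_subset_of_convex hA)
  by_contra hwA
  obtain ⟨l, s, hl1, hl2⟩ := geometric_hahn_banach_closed_point hA.closure isClosed_closure hwA
  obtain ⟨v, hv, hmax⟩ := (isCompact_closedBall (0 : E) ε).exists_isMaxOn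
    ⟨0, by simpa using hε⟩ l.continuous.continuousOn
  obtain ⟨c, hc, hwc⟩ := h (w + v) (by
    rw [Metric.mem_ball, dist_eq_norm] at hw ⊢
    rw [mem_closedBall_zero_iff] at hv
    calc ‖w + v - x‖ = ‖(w - x) + v‖ := by congr 1; abel
      _ ≤ ‖w - x‖ + ‖v‖ := norm_add_le _ _
      _ < ρ := by linarith)
  have h1 : l (w + v - c) ≤ l v := hmax (by simpa using hwc)
  have h2 := hl1 c (subset_closure hc)
  simp only [map_sub, map_add] at h1
  linarith

variable {m k : ℕ}

/-- The right-hand sides for which the moment constraints can be met within `K`. A point of `K`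
lists the objective, the inequality moments and the equality moments. -/
def attainable (K : Set (ℝ × (Fin m → ℝ) × (Fin k → ℝ))) : Set ((Fin m → ℝ) × (Fin k → ℝ)) :=
  {w | ∃ z ∈ K, z.2.1 ≤ w.1 ∧ z.2.2 = w.2}

/-- The points of `K` that satisfy the moment constraints. -/
def momentFeasible (K : Set (ℝ × (Fin m → ℝ) × (Fin k → ℝ))) (μ : Fin m → ℝ) (ν : Fin k → ℝ) :
    Set (ℝ × (Fin m → ℝ) × (Fin k → ℝ)) :=
  {z | z ∈ K ∧ z.2.1 ≤ μ ∧ z.2.2 = ν}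

theorem convex_attainable {K : Set (ℝ × (Fin m → ℝ) × (Fin k → ℝ))} (hK : Convex ℝ K) :
    Convex ℝ (attainable K) := by
  rintro w ⟨z, hz, h1, h2⟩ w' ⟨z', hz', h1', h2'⟩ s t hs ht hst
  refine ⟨s • z + t • z', hK hz hz' hs ht hst, ?_, ?_⟩
  · simp only [Prod.snd_add, Prod.fst_add, Prod.smul_snd, Prod.smul_fst]
    gcongr
  · simp [h2, h2']

theorem ball_subset_attainable_of_approx {K K' : Set (ℝ × (Fin m → ℝ) × (Fin k → ℝ))}
    (hK' : Convex ℝ K') {w : (Fin m → ℝ) × (Fin k → ℝ)} {ρ ε : ℝ} (hε : 0 ≤ ε)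
    (happ : ∀ z ∈ K, ∃ z' ∈ K', ‖z - z'‖ ≤ ε) (hball : Metric.ball w ρ ⊆ attainable K) :
    Metric.ball w (ρ - ε) ⊆ attainable K' := by
  refine ball_subset_of_convex_of_approx (convex_attainable hK') hε fun y hy => ?_
  obtain ⟨z, hz, h1, h2⟩ := hball hy
  obtain ⟨z', hz', h3⟩ := happ z hz
  -- The slack `y.1 - z.2.1` is carried over to `z'`, so the distance to `y` is only that between
  -- the moments of `z` and `z'`.
  refine ⟨(y.1 - z.2.1 + z'.2.1, z'.2.2), ⟨z', hz', ?_, rfl⟩, le_trans ?_ h3⟩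
  · simpa using h1
  · rw [show y - (y.1 - z.2.1 + z'.2.1, z'.2.2) = (z - z').2 from
      Prod.ext (by simp; abel) (by simp [h2])]
    exact norm_snd_le _

/-- The nearby point `z` violates the constraints by at most `ε`. Mixing it with a point `w` of `K`
that errs in the opposite direction by `ρ / ε` times as much restores feasibility. The weight of `w`
is of order `ε / ρ`, which bounds the loss in the objective. -/
theorem exists_momentFeasible_of_approx {K : Set (ℝ × (Fin m → ℝ) × (Fin k → ℝ))}
    (hK : Convex ℝ K) {B : ℝ} (hB : ∀ z ∈ K, |z.1| ≤ B) {μ : Fin m → ℝ} {ν : Fin k → ℝ} {ρ ε : ℝ}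
    (hρ : 0 < ρ) (hε : 0 < ε)
    (hball : Metric.closedBall (μ, ν) ρ ⊆ attainable K)
    {y : ℝ × (Fin m → ℝ) × (Fin k → ℝ)} (hy1 : y.2.1 ≤ μ) (hy2 : y.2.2 = ν)
    {z : ℝ × (Fin m → ℝ) × (Fin k → ℝ)} (hz : z ∈ K) (hyz : ‖y - z‖ ≤ ε) :
    ∃ z' ∈ momentFeasible K μ ν, y.1 ≤ z'.1 + (1 + 2 * B / ρ) * ε := by
  have e1 : ‖y.1 - z.1‖ ≤ ε := (norm_fst_le (y - z)).trans hyz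
  have e2 : ‖y.2.1 - z.2.1‖ ≤ ε := ((norm_fst_le (y - z).2).trans (norm_snd_le _)).trans hyz
  have e3 : ‖y.2.2 - z.2.2‖ ≤ ε := ((norm_snd_le (y - z).2).trans (norm_snd_le _)).trans hyz
  -- With weights `ρ / (ε + ρ)` on `z` and `ε / (ε + ρ)` on `w`, this target cancels the equality
  -- error exactly and offsets an excess of `ε` in the inequalities.
  obtain ⟨w, hw, hw1, hw2⟩ := hball (a := (μ - (fun _ => ρ), ν - (ρ / ε) • (z.2.2 - ν))) (by
    rw [mem_closedBall_iff_norm, Prod.norm_def]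
    refine max_le ?_ ?_
    · simp only [Prod.fst_sub, sub_sub_cancel_left, norm_neg]
      exact (pi_norm_const_le _).trans (by simp [abs_of_pos hρ])
    · simp only [Prod.snd_sub, sub_sub_cancel_left, norm_neg]
      rw [norm_smul, Real.norm_of_nonneg (by positivity), norm_sub_rev, ← hy2]
      calc ρ / ε * _ ≤ ρ / ε * ε := by gcongr
        _ = ρ := by field_simp)
  have hs : 0 < ε + ρ := by positivity
  have hBw := abs_le.1 (hB w hw)
  have hBz := abs_le.1 (hB z hz)
  have hB0 : 0 ≤ B := (abs_nonneg _).trans (hB z hz)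
  refine ⟨(ρ / (ε + ρ)) • z + (ε / (ε + ρ)) • w,
    ⟨hK hz hw (by positivity) (by positivity) (by field_simp; ring), fun j => ?_, ?_⟩, ?_⟩
  · have h1 := (norm_le_pi_norm (y.2.1 - z.2.1) j).trans e2
    have h2 := hw1 j
    have h3 := hy1 j
    simp only [Pi.sub_apply, Real.norm_eq_abs] at h1 h2
    have h1 := abs_le.1 h1
    simp only [Prod.snd_add, Prod.fst_add, Prod.smul_snd, Prod.smul_fst, Pi.add_apply,
      Pi.smul_apply, smul_eq_mul]
    calc ρ / (ε + ρ) * z.2.1 j + ε / (ε + ρ) * w.2.1 j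
        ≤ ρ / (ε + ρ) * (μ j + ε) + ε / (ε + ρ) * (μ j - ρ) := by
          gcongr
          linarith
      _ = μ j := by field_simp; ring
  · simp only [Prod.snd_add, Prod.smul_snd, hw2]
    ext j
    simp only [Pi.add_apply, Pi.smul_apply, Pi.sub_apply, smul_eq_mul]
    field_simp
    ring
  · have h1 := abs_le.1 (Real.norm_eq_abs _ ▸ e1)
    simp only [Prod.fst_add, Prod.smul_fst, smul_eq_mul]
    have h2 : ρ / (ε + ρ) * z.1 + ε / (ε + ρ) * w.1 = z.1 - ε / (ε + ρ) * (z.1 - w.1) := by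
      field_simp; ring
    have h3 : ε / (ε + ρ) * (z.1 - w.1) ≤ ε / ρ * (2 * B) := by
      calc ε / (ε + ρ) * (z.1 - w.1) ≤ ε / (ε + ρ) * (2 * B) := by gcongr; linarith
        _ ≤ ε / ρ * (2 * B) := by gcongr; linarith
    have h4 : ε / ρ * (2 * B) = 2 * B / ρ * ε := by ring
    rw [h2]
    linarith

/-- Convexity, boundedness and the ball are asked of `K` alone, so the reverse estimate follows by
exchanging the roles once these are known for `K'`. -/
theorem optVal_momentFeasible_le {K K' : Set (ℝ × (Fin m → ℝ) × (Fin k → ℝ))}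
    (hK : Convex ℝ K) {B : ℝ} (hB : ∀ z ∈ K, |z.1| ≤ B) {μ : Fin m → ℝ} {ν : Fin k → ℝ} {ρ ε : ℝ}
    (hρ : 0 < ρ) (hε : 0 < ε) (hball : Metric.closedBall (μ, ν) ρ ⊆ attainable K)
    (happ : ∀ y ∈ K', ∃ z ∈ K, ‖y - z‖ ≤ ε) :
    optVal (momentFeasible K' μ ν) Prod.fst ≤
      optVal (momentFeasible K μ ν) Prod.fst + (((1 + 2 * B / ρ) * ε : ℝ) : EReal) := by
  refine iSup₂_le fun y hy => ?_
  obtain ⟨z, hz, hyz⟩ := happ y hy.1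
  obtain ⟨z', hz', h⟩ := exists_momentFeasible_of_approx hK hB hρ hε hball hy.2.1 hy.2.2 hz hyz
  calc ((y.1 : ℝ) : EReal) ≤ ((z'.1 + (1 + 2 * B / ρ) * ε : ℝ) : EReal) := by exact_mod_cast h
    _ = (z'.1 : EReal) + (((1 + 2 * B / ρ) * ε : ℝ) : EReal) := EReal.coe_add _ _
    _ ≤ _ := by
      gcongr
      exact le_iSup₂ (f := fun (x : ℝ × (Fin m → ℝ) × (Fin k → ℝ))
        (_ : x ∈ momentFeasible K μ ν) => (x.1 : EReal)) z' hz'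

theorem EReal_abs_sub_le {x y : EReal} (hy : ∃ r : ℝ, y = r) {c : ℝ}
    (h1 : x ≤ y + (c : EReal)) (h2 : y ≤ x + (c : EReal)) :
    (x - y).abs ≤ ENNReal.ofReal c := by
  obtain ⟨r, rfl⟩ := hy
  induction x with
  | bot => simp at h2
  | top => rw [← EReal.coe_add] at h1; exact absurd h1 (EReal.coe_lt_top _).not_ge
  | coe x =>
    rw [← EReal.coe_sub, EReal.abs_def]
    apply ENNReal.ofReal_le_ofReal
    have h1 : x ≤ r + c := by exact_mod_cast h1
    have h2 : r ≤ x + c := by exact_mod_cast h2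
    exact abs_le.2 ⟨by linarith, by linarith⟩

theorem exists_optVal_eq_coe {α : Type*} {S : Set α} {obj : α → ℝ} (hS : S.Nonempty) {B : ℝ}
    (hB : ∀ x ∈ S, obj x ≤ B) : ∃ r : ℝ, optVal S obj = r := by
  obtain ⟨x, hx⟩ := hS
  have h1 : optVal S obj ≤ (B : EReal) := iSup₂_le fun y hy => by exact_mod_cast hB y hy
  have h2 : (obj x : EReal) ≤ optVal S obj := le_iSup₂ (f := fun x (_ : x ∈ S) => (obj x : EReal)) x hx
  refine ⟨(optVal S obj).toReal, (EReal.coe_toReal ?_ ?_).symm⟩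
  · exact (h1.trans_lt (EReal.coe_lt_top B)).ne
  · exact ((EReal.bot_lt_coe _).trans_le h2).ne'

/-- Under the Slater condition, the optimal value depends continuously on the convex set of
attainable moments, with an explicit Lipschitz constant. -/
theorem abs_optVal_sub_le {K K' : Set (ℝ × (Fin m → ℝ) × (Fin k → ℝ))}
    (hK : Convex ℝ K) (hK' : Convex ℝ K') {B : ℝ} (hB : ∀ z ∈ K, |z.1| ≤ B)
    {μ : Fin m → ℝ} {ν : Fin k → ℝ} {ρ ε : ℝ} (hε : 0 < ε) (hερ : ε < ρ)
    (hball : Metric.ball (μ, ν) (3 * ρ) ⊆ attainable K)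
    (happ : ∀ z ∈ K, ∃ y ∈ K', ‖z - y‖ ≤ ε) (happ' : ∀ y ∈ K', ∃ z ∈ K, ‖y - z‖ ≤ ε) :
    (optVal (momentFeasible K' μ ν) Prod.fst - optVal (momentFeasible K μ ν) Prod.fst).abs ≤
      ENNReal.ofReal ((1 + 2 * (B + ρ) / ρ) * ε) := by
  have hρ : 0 < ρ := hε.trans hερ
  -- The radius `3 * ρ` shrinks by `ε < ρ` in passing to `K'`, which leaves room for a closed ball
  -- of radius `ρ`.
  have hball' : Metric.closedBall (μ, ν) ρ ⊆ attainable K' :=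
    (Metric.closedBall_subset_ball (by linarith)).trans
      (ball_subset_attainable_of_approx hK' hε.le happ hball)
  have hB' : ∀ y ∈ K', |y.1| ≤ B + ρ := fun y hy => by
    obtain ⟨z, hz, hyz⟩ := happ' y hy
    have e1 : |y.1 - z.1| ≤ ε := (norm_fst_le (y - z)).trans hyz
    have := abs_sub_abs_le_abs_sub y.1 z.1
    linarith [hB z hz]
  have hballK : Metric.closedBall (μ, ν) ρ ⊆ attainable K :=
    (Metric.closedBall_subset_ball (by linarith)).trans hball
  refine EReal_abs_sub_le ?_ ?_ ?_
  · obtain ⟨z, hz, h1, h2⟩ := hballK (Metric.mem_closedBall_self hρ.le)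
    exact exists_optVal_eq_coe ⟨z, hz, h1, h2⟩ fun y hy => (le_abs_self _).trans (hB y hy.1)
  · exact optVal_momentFeasible_le hK (fun z hz => (hB z hz).trans (by linarith)) hρ hε hballK happ'
  · exact optVal_momentFeasible_le hK' hB' hρ hε hball' happ

/-- The Slater condition makes the right-hand side interior to the set of attainable ones. -/
theorem exists_ball_subset_attainable {K : Set (ℝ × (Fin m → ℝ) × (Fin k → ℝ))}
    (hK : Convex ℝ K) {B : ℝ} (hB : ∀ z ∈ K, ∀ j, |z.2.1 j| ≤ B) {μ : Fin m → ℝ} {ν : Fin k → ℝ}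
    (hstrict : ∃ z ∈ K, (∀ j, z.2.1 j < μ j) ∧ z.2.2 = ν)
    (hint : ν ∈ interior ((fun z : ℝ × (Fin m → ℝ) × (Fin k → ℝ) => z.2.2) '' K)) :
    ∃ ρ > 0, Metric.ball (μ, ν) ρ ⊆ attainable K := by
  obtain ⟨z, hz, hzμ, hzν⟩ := hstrict
  obtain ⟨r, hr, hrK⟩ := Metric.mem_nhds_iff.1 (mem_interior_iff_mem_nhds.1 hint)
  obtain ⟨η, hη, hzη⟩ : ∃ η > 0, ∀ j, z.2.1 j ≤ μ j - η := by
    rcases isEmpty_or_nonempty (Fin m) with h | h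
    · exact ⟨1, one_pos, fun j => isEmptyElim j⟩
    · obtain ⟨j, hj⟩ := Finite.exists_min fun j => μ j - z.2.1 j
      exact ⟨μ j - z.2.1 j, sub_pos.2 (hzμ j), fun i => by linarith [hj i]⟩
  -- `s` is the weight of a point `y` that corrects the equality moments. It costs at most half of
  -- the Slater slack `η`; the other half absorbs the change of the inequality levels.
  obtain ⟨s, hs0, hs1, hsB⟩ : ∃ s : ℝ, 0 < s ∧ s ≤ 1 ∧ s * (2 * |B|) ≤ η / 2 := by
    refine ⟨min 1 (η / (4 * (|B| + 1))), by positivity, min_le_left _ _, ?_⟩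
    calc min 1 (η / (4 * (|B| + 1))) * (2 * |B|) ≤ η / (4 * (|B| + 1)) * (2 * (|B| + 1)) := by
          gcongr
          · exact min_le_right _ _
          · linarith
      _ = η / 2 := by field_simp; norm_num
  refine ⟨min (η / 2) (s * r), by positivity, fun w hw => ?_⟩
  rw [Metric.mem_ball, dist_eq_norm, Prod.norm_def, max_lt_iff] at hw
  have hw1 : ‖w.1 - μ‖ < η / 2 := hw.1.trans_le (min_le_left _ _)
  have hw2 : ‖w.2 - ν‖ < s * r := hw.2.trans_le (min_le_right _ _)
  -- The factor `s⁻¹` undoes the weight `s`, so the mixture has equality moments exactly `w.2`.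
  obtain ⟨y, hy, hyν⟩ := hrK (a := ν + s⁻¹ • (w.2 - ν)) (by
    rw [Metric.mem_ball, dist_eq_norm, add_sub_cancel_left, norm_smul,
      Real.norm_of_nonneg (by positivity)]
    calc s⁻¹ * ‖w.2 - ν‖ < s⁻¹ * (s * r) := by gcongr
      _ = r := by field_simp)
  simp only at hyν
  refine ⟨(1 - s) • z + s • y, hK hz hy (by linarith) hs0.le (by ring), fun j => ?_, ?_⟩
  · have h1 := (norm_le_pi_norm (w.1 - μ) j).trans_lt hw1
    simp only [Pi.sub_apply, Real.norm_eq_abs] at h1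
    have h1 := abs_lt.1 h1
    have h2 := abs_le.1 ((hB y hy j).trans (le_abs_self B))
    have h3 := abs_le.1 ((hB z hz j).trans (le_abs_self B))
    have h4 : s * (y.2.1 j - z.2.1 j) ≤ s * (2 * |B|) := by gcongr; linarith
    simp only [Prod.snd_add, Prod.fst_add, Prod.smul_snd, Prod.smul_fst, Pi.add_apply,
      Pi.smul_apply, smul_eq_mul]
    linarith [hzη j]
  · simp only [Prod.snd_add, Prod.smul_snd, hzν, hyν]
    ext j
    simp only [Pi.add_apply, Pi.smul_apply, Pi.sub_apply, smul_eq_mul]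
    field_simp
    ring

end IWSAA

noncomputable section

namespace IWSAA

/-! ### Step function approximation of antitone functions on a grid -/

variable {d : ℕ}

/-- The node with multi-index `κ` of the grid that cuts every edge of `[a, b]` into `N` pieces. -/
def gridPoint (a b : Fin d → ℝ) (N : ℕ) (κ : Fin d → ℕ) : Fin d → ℝ :=
  fun i => a i + κ i * ((b i - a i) / N)

/-- The half-open grid cell whose least node has multi-index `κ`. -/
def gridCell (a b : Fin d → ℝ) (N : ℕ) (κ : Fin d → ℕ) : Set (Fin d → ℝ) :=
  Set.pi Set.univ fun i => Set.Ico (gridPoint a b N κ i) (gridPoint a b N (κ + 1) i)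

/-- The multi-indices of the cells. -/
def gridIndex (d N : ℕ) : Finset (Fin d → ℕ) :=
  Fintype.piFinset fun _ => Finset.range N

theorem mem_gridIndex {N : ℕ} {κ : Fin d → ℕ} : κ ∈ gridIndex d N ↔ ∀ i, κ i < N := by
  simp [gridIndex]

theorem measurableSet_gridCell (a b : Fin d → ℝ) (N : ℕ) (κ : Fin d → ℕ) :
    MeasurableSet (gridCell a b N κ) :=
  MeasurableSet.univ_pi fun _ => measurableSet_Ico

theorem gridPoint_mem_Icc {a b : Fin d → ℝ} (hab : ∀ i, a i < b i) {N : ℕ} (hN : 0 < N)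
    {κ : Fin d → ℕ} (hκ : ∀ i, κ i ≤ N) : gridPoint a b N κ ∈ Set.Icc a b := by
  have hN' : (0 : ℝ) < N := by exact_mod_cast hN
  refine ⟨fun i => ?_, fun i => ?_⟩
  · have : 0 ≤ b i - a i := sub_nonneg.2 (hab i).le
    simp only [gridPoint]
    have : 0 ≤ (κ i : ℝ) * ((b i - a i) / N) := by positivity
    linarith
  · have h0 : 0 ≤ b i - a i := sub_nonneg.2 (hab i).le
    have h1 : (κ i : ℝ) * ((b i - a i) / N) ≤ N * ((b i - a i) / N) := by
      gcongr
      exact_mod_cast hκ i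
    have h2 : (N : ℝ) * ((b i - a i) / N) = b i - a i := by field_simp
    simp only [gridPoint]
    linarith

theorem gridPoint_mono {a b : Fin d → ℝ} (hab : ∀ i, a i < b i) (N : ℕ) :
    Monotone (gridPoint a b N) := by
  intro κ κ' h i
  have : 0 ≤ b i - a i := sub_nonneg.2 (hab i).le
  simp only [gridPoint]
  gcongr
  exact h i

/-- Computing the cell index by a floor yields both disjointness and covering. -/
theorem mem_gridCell_iff {a b : Fin d → ℝ} (hab : ∀ i, a i < b i) {N : ℕ} (hN : 0 < N)
    {x : Fin d → ℝ} (hx : ∀ i, a i ≤ x i) {κ : Fin d → ℕ} :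
    x ∈ gridCell a b N κ ↔ κ = fun i => ⌊(x i - a i) / ((b i - a i) / N)⌋₊ := by
  have hN' : (0 : ℝ) < N := by exact_mod_cast hN
  rw [funext_iff, gridCell, Set.mem_univ_pi]
  refine forall_congr' fun i => ?_
  have hh : 0 < (b i - a i) / N := div_pos (sub_pos.2 (hab i)) hN'
  rw [eq_comm, Nat.floor_eq_iff (div_nonneg (sub_nonneg.2 (hx i)) hh.le), le_div_iff₀ hh,
    div_lt_iff₀ hh]
  simp only [gridPoint, Set.mem_Ico, Pi.add_apply, Pi.one_apply, Nat.cast_add, Nat.cast_one]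
  constructor <;> rintro ⟨h1, h2⟩ <;> constructor <;> linarith

theorem le_of_mem_gridCell {a b : Fin d → ℝ} (hab : ∀ i, a i < b i) {N : ℕ}
    {x : Fin d → ℝ} {κ : Fin d → ℕ} (hx : x ∈ gridCell a b N κ) (i : Fin d) : a i ≤ x i := by
  have h := (hx i (Set.mem_univ i)).1
  have h0 : 0 ≤ b i - a i := sub_nonneg.2 (hab i).le
  have : 0 ≤ (κ i : ℝ) * ((b i - a i) / N) := by positivity
  simp only [gridPoint] at h
  linarith

theorem eq_of_mem_gridCell {a b : Fin d → ℝ} (hab : ∀ i, a i < b i) {N : ℕ} (hN : 0 < N)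
    {x : Fin d → ℝ} {κ κ' : Fin d → ℕ} (h : x ∈ gridCell a b N κ) (h' : x ∈ gridCell a b N κ') :
    κ = κ' := by
  have hx := le_of_mem_gridCell hab h
  rw [(mem_gridCell_iff hab hN hx).1 h, (mem_gridCell_iff hab hN hx).1 h']

theorem exists_mem_gridCell {a b : Fin d → ℝ} (hab : ∀ i, a i < b i) {N : ℕ} (hN : 0 < N)
    {x : Fin d → ℝ} (hx : ∀ i, a i ≤ x i) (hx' : ∀ i, x i < b i) :
    ∃ κ ∈ gridIndex d N, x ∈ gridCell a b N κ := by
  have hN' : (0 : ℝ) < N := by exact_mod_cast hN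
  refine ⟨_, mem_gridIndex.2 fun i => ?_, (mem_gridCell_iff hab hN hx).2 rfl⟩
  have hh : 0 < (b i - a i) / N := div_pos (sub_pos.2 (hab i)) hN'
  rw [Nat.floor_lt (div_nonneg (sub_nonneg.2 (hx i)) hh.le), div_lt_iff₀ hh]
  have : (N : ℝ) * ((b i - a i) / N) = b i - a i := by field_simp
  linarith [hx' i]

theorem volume_gridCell {a b : Fin d → ℝ} (N : ℕ) (κ : Fin d → ℕ) :
    volume (gridCell a b N κ) = ∏ i, ENNReal.ofReal ((b i - a i) / N) := by
  rw [gridCell, Real.volume_pi_Ico]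
  refine Finset.prod_congr rfl fun i _ => ?_
  congr 1
  simp only [gridPoint, Pi.add_apply, Pi.one_apply, Nat.cast_add, Nat.cast_one]
  ring

/-- A sum over the cells, at a point of a cell, is the term of that cell. -/
theorem sum_indicator_gridCell {a b : Fin d → ℝ} (hab : ∀ i, a i < b i) {N : ℕ} (hN : 0 < N)
    {x : Fin d → ℝ} {κ : Fin d → ℕ} (hκ : κ ∈ gridIndex d N) (hx : x ∈ gridCell a b N κ)
    (c : (Fin d → ℕ) → ℝ) (w : (Fin d → ℝ) → ℝ) :
    ∑ κ' ∈ gridIndex d N, c κ' * (gridCell a b N κ').indicator w x = c κ * w x := by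
  rw [Finset.sum_eq_single_of_mem κ hκ, Set.indicator_of_mem hx]
  intro κ' _ hne
  rw [Set.indicator_of_notMem, mul_zero]
  exact fun h => hne (eq_of_mem_gridCell hab hN h hx)

theorem sum_indicator_gridCell_le {a b : Fin d → ℝ} (hab : ∀ i, a i < b i) {N : ℕ} (hN : 0 < N)
    (x : Fin d → ℝ) {w : (Fin d → ℝ) → ℝ} (hw : 0 ≤ w x) :
    ∑ κ ∈ gridIndex d N, (gridCell a b N κ).indicator w x ≤ w x := by
  by_cases h : ∃ κ ∈ gridIndex d N, x ∈ gridCell a b N κ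
  · obtain ⟨κ, hκ, hx⟩ := h
    have := sum_indicator_gridCell hab hN hκ hx (fun _ => 1) w
    simp only [one_mul] at this
    exact this.le
  · rw [Finset.sum_eq_zero]
    · exact hw
    · intro κ hκ
      exact Set.indicator_of_notMem (fun hx => h ⟨κ, hκ, hx⟩) _

/-- On a cell, an antitone `f` lies between its values at the greatest and the least node, and the
step function takes the latter. -/
theorem abs_mul_sub_sum_gridCell_le {a b : Fin d → ℝ} (hab : ∀ i, a i < b i) {N : ℕ} (hN : 0 < N)
    {f : (Fin d → ℝ) → ℝ} (hf : AntitoneOn f (Set.Icc a b)) (w : (Fin d → ℝ) → ℝ)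
    {x : Fin d → ℝ} (hx : ∀ i, a i ≤ x i) (hx' : ∀ i, x i < b i) :
    |w x * f x - ∑ κ ∈ gridIndex d N, f (gridPoint a b N κ) * (gridCell a b N κ).indicator w x| ≤
      ∑ κ ∈ gridIndex d N, (f (gridPoint a b N κ) - f (gridPoint a b N (κ + 1))) *
        (gridCell a b N κ).indicator (fun x => |w x|) x := by
  obtain ⟨κ, hκ, hxκ⟩ := exists_mem_gridCell hab hN hx hx'
  rw [sum_indicator_gridCell hab hN hκ hxκ (fun κ => f (gridPoint a b N κ)),
    sum_indicator_gridCell hab hN hκ hxκ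
      (fun κ => f (gridPoint a b N κ) - f (gridPoint a b N (κ + 1)))]
  have hκ' := mem_gridIndex.1 hκ
  have m1 := gridPoint_mem_Icc hab hN fun i => (hκ' i).le
  have m2 := gridPoint_mem_Icc hab hN (κ := κ + 1) fun i => hκ' i
  have m3 : x ∈ Set.Icc a b := ⟨hx, fun i => (hx' i).le⟩
  have h1 : f x ≤ f (gridPoint a b N κ) := hf m1 m3 fun i => (hxκ i (Set.mem_univ i)).1
  have h2 : f (gridPoint a b N (κ + 1)) ≤ f x := hf m3 m2 fun i => (hxκ i (Set.mem_univ i)).2.le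
  rw [show w x * f x - f (gridPoint a b N κ) * w x = -((f (gridPoint a b N κ) - f x) * w x) by ring,
    abs_neg, abs_mul, abs_of_nonneg (sub_nonneg.2 h1)]
  gcongr

/-- Telescoping along the diagonals: the oscillations of a bounded function over the cells of the
grid sum to at most the number of boundary cells. -/
theorem sum_gridIndex_sub_le {M : ℝ} {N : ℕ} (hN : 0 < N) {F : (Fin d → ℕ) → ℝ}
    (hF : ∀ κ : Fin d → ℕ, (∀ i, κ i ≤ N) → 0 ≤ F κ ∧ F κ ≤ M) :
    ∑ κ ∈ gridIndex d N, (F κ - F (κ + 1)) ≤ M * ((N : ℝ) ^ d - ((N : ℝ) - 1) ^ d) := by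
  classical
  set S := gridIndex d N
  set T : Finset (Fin d → ℕ) := S.map (addRightEmbedding 1) with hT
  have hTsum : ∑ κ ∈ S, F (κ + 1) = ∑ κ ∈ T, F κ := by simp [hT]
  have hS0 : ∀ κ ∈ S, 0 ≤ F κ ∧ F κ ≤ M := fun κ hκ =>
    hF κ fun i => (mem_gridIndex.1 hκ i).le
  have hT0 : ∀ κ ∈ T, 0 ≤ F κ := by
    intro κ hκ
    obtain ⟨κ', hκ', rfl⟩ := Finset.mem_map.1 hκ
    exact (hF _ fun i => mem_gridIndex.1 hκ' i).1
  -- The indices common to `S` and its diagonal shift `T`; their terms cancel. The remaining terms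
  -- of `T` are nonnegative and are dropped.
  set I : Finset (Fin d → ℕ) := Fintype.piFinset fun _ => Finset.Ico 1 N with hI
  have hIS : I ⊆ S := fun κ hκ => mem_gridIndex.2 fun i =>
    (Finset.mem_Ico.1 (Fintype.mem_piFinset.1 hκ i)).2
  have hIT : I ⊆ T := by
    intro κ hκ
    have h := fun i => Finset.mem_Ico.1 (Fintype.mem_piFinset.1 hκ i)
    refine Finset.mem_map.2 ⟨κ - 1, mem_gridIndex.2 fun i => ?_, ?_⟩
    · have := h i; simp only [Pi.sub_apply, Pi.one_apply]; omega
    · funext i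
      have := h i; simp only [addRightEmbedding_apply, Pi.add_apply, Pi.sub_apply, Pi.one_apply]
      omega
  rw [Finset.sum_sub_distrib, hTsum, ← Finset.sum_sdiff hIS, ← Finset.sum_sdiff hIT]
  have h1 : 0 ≤ ∑ κ ∈ T \ I, F κ :=
    Finset.sum_nonneg fun κ hκ => hT0 κ (Finset.mem_sdiff.1 hκ).1
  have h2 : ∑ κ ∈ S \ I, F κ ≤ (S \ I).card * M := by
    rw [← nsmul_eq_mul]
    exact Finset.sum_le_card_nsmul _ _ _ fun κ hκ => (hS0 κ (Finset.mem_sdiff.1 hκ).1).2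
  have h3 : ((S \ I).card : ℝ) = (N : ℝ) ^ d - ((N : ℝ) - 1) ^ d := by
    rw [Finset.cast_card_sdiff hIS]
    simp [S, hI, gridIndex, Fintype.card_piFinset, Nat.cast_sub hN]
  rw [h3] at h2
  linarith

/-- On a fine grid, the mean oscillation of functions with values in `[0, M]` that decrease along
the diagonals is uniformly small, with respect to an integrable weight and a measure with bounded
density. -/
theorem exists_sum_oscillation_le {a b : Fin d → ℝ} (hab : ∀ i, a i < b i) {M : ℝ} (hM : 0 ≤ M)
    {Q : Measure (Fin d → ℝ)} [IsFiniteMeasure Q] {C : ℝ} (hC : 0 ≤ C)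
    (hQ : ∀ S, Q S ≤ ENNReal.ofReal C * volume S) {w : (Fin d → ℝ) → ℝ} (hw : Integrable w Q)
    {η : ℝ} (hη : 0 < η) :
    ∃ N : ℕ, 0 < N ∧ ∀ F : (Fin d → ℕ) → ℝ,
      (∀ κ : Fin d → ℕ, (∀ i, κ i ≤ N) → 0 ≤ F κ ∧ F κ ≤ M) →
      (∀ κ ∈ gridIndex d N, F (κ + 1) ≤ F κ) →
      ∑ κ ∈ gridIndex d N, (F κ - F (κ + 1)) *
        ∫ x, (gridCell a b N κ).indicator (fun x => |w x|) x ∂Q ≤ η := by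
  -- The excess of `|w|` over level `R`. The level is fixed first to make its integral small, and
  -- `N` is chosen afterwards, depending on `R`.
  let tail : ℕ → (Fin d → ℝ) → ℝ := fun R x => |w x| - min |w x| R
  have htail0 : ∀ R x, 0 ≤ tail R x := fun R x => sub_nonneg.2 (min_le_left _ _)
  have htail_le : ∀ R x, tail R x ≤ |w x| := fun R x =>
    sub_le_self _ (le_min (abs_nonneg _) (Nat.cast_nonneg R))
  have htail_int : ∀ R, Integrable (tail R) Q := fun R =>
    hw.abs.sub (hw.abs.inf (integrable_const _))
  have htail_lim : Tendsto (fun R => ∫ x, tail R x ∂Q) atTop (𝓝 0) := by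
    have : Tendsto (fun R => ∫ x, tail R x ∂Q) atTop (𝓝 (∫ _, (0 : ℝ) ∂Q)) := by
      refine tendsto_integral_of_dominated_convergence (fun x => |w x|)
        (fun R => (htail_int R).1) hw.abs (fun R => Eventually.of_forall fun x => ?_)
        (Eventually.of_forall fun x => ?_)
      · rw [Real.norm_of_nonneg (htail0 R x)]; exact htail_le R x
      · refine tendsto_const_nhds.congr' ?_
        obtain ⟨R₀, hR₀⟩ := exists_nat_ge |w x|
        filter_upwards [eventually_ge_atTop R₀] with R hR
        have : |w x| ≤ R := hR₀.trans (by exact_mod_cast hR)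
        simp [tail, this]
    simpa using this
  obtain ⟨R, hR⟩ : ∃ R : ℕ, M * ∫ x, tail R x ∂Q < η / 2 := by
    have := htail_lim.const_mul M
    rw [mul_zero] at this
    exact (this.eventually_lt_const (half_pos hη)).exists
  set V : ℝ := ∏ i, (b i - a i) with hV
  have hV0 : 0 ≤ V := Finset.prod_nonneg fun i _ => sub_nonneg.2 (hab i).le
  obtain ⟨N, hNη, hN⟩ : ∃ N : ℕ, R * (C * V) * (M * (1 - (1 - (N : ℝ)⁻¹) ^ d)) < η / 2 ∧ 0 < N := by
    have h1 : Tendsto (fun N : ℕ => R * (C * V) * (M * (1 - (1 - (N : ℝ)⁻¹) ^ d))) atTop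
        (𝓝 (R * (C * V) * (M * (1 - (1 - 0) ^ d)))) := by
      refine Tendsto.const_mul _ (Tendsto.const_mul _ (tendsto_const_nhds.sub (Tendsto.pow ?_ _)))
      exact tendsto_const_nhds.sub tendsto_inv_atTop_nhds_zero_nat
    simp only [sub_zero, one_pow, sub_self, mul_zero] at h1
    exact ((h1.eventually_lt_const (half_pos hη)).and (eventually_gt_atTop 0)).exists
  refine ⟨N, hN, fun F hF hFanti => ?_⟩
  have hN' : (0 : ℝ) < N := by exact_mod_cast hN
  have hD0 : ∀ κ ∈ gridIndex d N, 0 ≤ F κ - F (κ + 1) := fun κ hκ => sub_nonneg.2 (hFanti κ hκ)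
  have hDM : ∀ κ ∈ gridIndex d N, F κ - F (κ + 1) ≤ M := fun κ hκ => by
    have h1 := (hF κ fun i => (mem_gridIndex.1 hκ i).le).2
    have h2 := (hF (κ + 1) fun i => mem_gridIndex.1 hκ i).1
    linarith
  have hcell : ∀ κ, Q.real (gridCell a b N κ) ≤ C * (V / N ^ d) := by
    intro κ
    have h1 : ∏ i, ENNReal.ofReal ((b i - a i) / N) = ENNReal.ofReal (V / N ^ d) := by
      rw [← ENNReal.ofReal_prod_of_nonneg fun i _ =>
        div_nonneg (sub_nonneg.2 (hab i).le) hN'.le, Finset.prod_div_distrib]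
      simp [hV]
    refine ENNReal.toReal_le_of_le_ofReal (by positivity) ((hQ _).trans ?_)
    rw [volume_gridCell, h1, ENNReal.ofReal_mul hC]
  have hind : ∀ κ, ∫ x, (gridCell a b N κ).indicator (fun x => |w x|) x ∂Q ≤
      R * (C * (V / N ^ d)) + ∫ x, (gridCell a b N κ).indicator (tail R) x ∂Q := by
    intro κ
    have hm := measurableSet_gridCell a b N κ
    calc ∫ x, (gridCell a b N κ).indicator (fun x => |w x|) x ∂Q
        ≤ ∫ x, ((gridCell a b N κ).indicator (fun _ => (R : ℝ)) x +
            (gridCell a b N κ).indicator (tail R) x) ∂Q := by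
          refine integral_mono (hw.abs.indicator hm)
            (((integrable_const _).indicator hm).add ((htail_int R).indicator hm)) fun x => ?_
          by_cases hx : x ∈ gridCell a b N κ
          · simp only [Set.indicator_of_mem hx, tail]
            linarith [min_le_right |w x| (R : ℝ)]
          · simp [Set.indicator_of_notMem hx]
      _ = R * Q.real (gridCell a b N κ) + ∫ x, (gridCell a b N κ).indicator (tail R) x ∂Q := by
          rw [integral_add ((integrable_const _).indicator hm) ((htail_int R).indicator hm),
            integral_indicator_const _ hm, smul_eq_mul, mul_comm]
      _ ≤ _ := by gcongr; exact hcell κ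
  have htailsum : ∑ κ ∈ gridIndex d N, ∫ x, (gridCell a b N κ).indicator (tail R) x ∂Q ≤
      ∫ x, tail R x ∂Q := by
    have hi := fun κ => (htail_int R).indicator (measurableSet_gridCell a b N κ)
    rw [← integral_finsetSum _ fun κ _ => hi κ]
    exact integral_mono (integrable_finsetSum _ fun κ _ => hi κ) (htail_int R)
      fun x => sum_indicator_gridCell_le hab hN x (htail0 R x)
  -- The truncated part uses the telescoped sum and the uniform bound on cell masses. The tail uses
  -- only that each oscillation is at most `M` and that the cells are disjoint.
  calc ∑ κ ∈ gridIndex d N, (F κ - F (κ + 1)) *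
        ∫ x, (gridCell a b N κ).indicator (fun x => |w x|) x ∂Q
      ≤ ∑ κ ∈ gridIndex d N, ((F κ - F (κ + 1)) * (R * (C * (V / N ^ d))) +
          M * ∫ x, (gridCell a b N κ).indicator (tail R) x ∂Q) := by
        refine Finset.sum_le_sum fun κ hκ => ?_
        have h0 : 0 ≤ ∫ x, (gridCell a b N κ).indicator (tail R) x ∂Q :=
          integral_nonneg fun x => Set.indicator_nonneg (fun x _ => htail0 R x) x
        calc _ ≤ (F κ - F (κ + 1)) * (R * (C * (V / N ^ d)) +
              ∫ x, (gridCell a b N κ).indicator (tail R) x ∂Q) :=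
              mul_le_mul_of_nonneg_left (hind κ) (hD0 κ hκ)
          _ ≤ _ := by
            rw [mul_add]
            gcongr
            exact hDM κ hκ
    _ = (∑ κ ∈ gridIndex d N, (F κ - F (κ + 1))) * (R * (C * (V / N ^ d))) +
          M * ∑ κ ∈ gridIndex d N, ∫ x, (gridCell a b N κ).indicator (tail R) x ∂Q := by
        rw [Finset.sum_add_distrib, Finset.sum_mul, Finset.mul_sum]
    _ ≤ M * ((N : ℝ) ^ d - ((N : ℝ) - 1) ^ d) * (R * (C * (V / N ^ d))) +
          M * ∫ x, tail R x ∂Q := by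
        gcongr
        exact sum_gridIndex_sub_le hN hF
    _ = R * (C * V) * (M * (1 - (1 - (N : ℝ)⁻¹) ^ d)) + M * ∫ x, tail R x ∂Q := by
        have h1 : 1 - (N : ℝ)⁻¹ = (N - 1) / N := by field_simp
        rw [h1, div_pow]
        field_simp
    _ ≤ η := by linarith

end IWSAA

end

noncomputable section

namespace IWSAA

/-! ### The uniform law of large numbers over the shape class -/

variable {d : ℕ}

/-- Superlevel sets within the box are order-connected, hence Lebesgue null-measurable. In several
variables they need not be Borel. -/
theorem aemeasurable_of_antitoneOn_Icc {a b : Fin d → ℝ} {f : (Fin d → ℝ) → ℝ}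
    (hf : AntitoneOn f (Set.Icc a b)) : AEMeasurable f (volume.restrict (Set.Icc a b)) := by
  refine NullMeasurable.aemeasurable ?_
  suffices h : @Measurable (NullMeasurableSpace (Fin d → ℝ) (volume.restrict (Set.Icc a b))) ℝ
      _ _ f from h
  refine measurable_of_Ioi fun c => ?_
  have hord : ({x | x ∈ Set.Icc a b ∧ c < f x} : Set (Fin d → ℝ)).OrdConnected := by
    refine ⟨fun x hx y hy z hz => ?_⟩
    have hz' : z ∈ Set.Icc a b := ⟨hx.1.1.trans hz.1, hz.2.trans hy.1.2⟩
    exact ⟨hz', lt_of_lt_of_le hy.2 (hf hz' hy.1 hz.2)⟩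
  have hnull : NullMeasurableSet {x | x ∈ Set.Icc a b ∧ c < f x}
      (volume.restrict (Set.Icc a b)) :=
    hord.nullMeasurableSet.mono_ac Measure.restrict_le_self.absolutelyContinuous
  have hae : {x | x ∈ Set.Icc a b ∧ c < f x} =ᵐ[volume.restrict (Set.Icc a b)] f ⁻¹' Set.Ioi c := by
    filter_upwards [ae_restrict_mem measurableSet_Icc] with x hx
    exact propext ⟨fun h => h.2, fun h => ⟨hx, h⟩⟩
  exact hnull.congr hae

theorem integrable_mul_of_mem_shapeClass {a b : Fin d → ℝ} {M : ℝ} {Q : Measure (Fin d → ℝ)}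
    (hQ : Q ≪ volume.restrict (Set.Icc a b)) {w f : (Fin d → ℝ) → ℝ} (hw : Integrable w Q)
    (hf : f ∈ shapeClass a b M) : Integrable (fun x => w x * f x) Q := by
  have hbox : ∀ᵐ x ∂Q, x ∈ Set.Icc a b := hQ.ae_le (ae_restrict_mem measurableSet_Icc)
  have hmeas : AEMeasurable f Q :=
    (aemeasurable_of_antitoneOn_Icc (mem_shapeClass_iff.1 hf).2).mono_ac hQ
  refine hw.mul_bdd (c := M) hmeas.aestronglyMeasurable ?_
  filter_upwards [hbox] with x hx
  rw [Real.norm_of_nonneg (hf.1 x hx).1]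
  exact (hf.1 x hx).2

/-- The average of `w` over the first `n` sample points. -/
def sampleMean {Ω : Type*} (X : ℕ → Ω → Fin d → ℝ) (w : (Fin d → ℝ) → ℝ) (n : ℕ) (ω : Ω) : ℝ :=
  (1 / (n : ℝ)) * ∑ i ∈ Finset.range n, w (X i ω)

section Sample

variable {Ω : Type*} {X : ℕ → Ω → Fin d → ℝ} {Q : Measure (Fin d → ℝ)}

theorem abs_sampleMean_sub_le {a b : Fin d → ℝ} (hab : ∀ i, a i < b i) {N : ℕ} (hN : 0 < N)
    {f : (Fin d → ℝ) → ℝ} (hf : AntitoneOn f (Set.Icc a b)) (w : (Fin d → ℝ) → ℝ) {ω : Ω}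
    (hω : ∀ i j, a j ≤ X i ω j ∧ X i ω j < b j) (n : ℕ) :
    |sampleMean X (fun x => w x * f x) n ω - ∑ κ ∈ gridIndex d N, f (gridPoint a b N κ) *
        sampleMean X ((gridCell a b N κ).indicator w) n ω| ≤
      ∑ κ ∈ gridIndex d N, (f (gridPoint a b N κ) - f (gridPoint a b N (κ + 1))) *
        sampleMean X ((gridCell a b N κ).indicator fun x => |w x|) n ω := by
  have e : ∀ (c : (Fin d → ℕ) → ℝ) (u : (Fin d → ℝ) → ℝ),
      ∑ κ ∈ gridIndex d N, c κ * sampleMean X ((gridCell a b N κ).indicator u) n ω =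
        (1 / (n : ℝ)) * ∑ i ∈ Finset.range n,
          ∑ κ ∈ gridIndex d N, c κ * (gridCell a b N κ).indicator u (X i ω) := by
    intro c u
    rw [Finset.sum_comm, Finset.mul_sum]
    refine Finset.sum_congr rfl fun κ _ => ?_
    rw [sampleMean, ← Finset.mul_sum]
    ring
  rw [e, e fun κ => f (gridPoint a b N κ) - f (gridPoint a b N (κ + 1)), sampleMean, ← mul_sub,
    ← Finset.sum_sub_distrib, abs_mul, abs_of_nonneg (by positivity : (0 : ℝ) ≤ 1 / n)]
  gcongr
  refine (Finset.abs_sum_le_sum_abs _ _).trans (Finset.sum_le_sum fun i _ => ?_)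
  exact abs_mul_sub_sum_gridCell_le hab hN hf w (fun j => (hω i j).1) (fun j => (hω i j).2)

theorem abs_integral_sub_le {a b : Fin d → ℝ} (hab : ∀ i, a i < b i) {M : ℝ}
    (hQac : Q ≪ volume.restrict (Set.Icc a b))
    (hQbox : ∀ᵐ x ∂Q, ∀ j, a j ≤ x j ∧ x j < b j) {N : ℕ} (hN : 0 < N)
    {f : (Fin d → ℝ) → ℝ} (hf : f ∈ shapeClass a b M) {w : (Fin d → ℝ) → ℝ}
    (hw : Integrable w Q) :
    |∫ x, w x * f x ∂Q - ∑ κ ∈ gridIndex d N, f (gridPoint a b N κ) *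
        ∫ x, (gridCell a b N κ).indicator w x ∂Q| ≤
      ∑ κ ∈ gridIndex d N, (f (gridPoint a b N κ) - f (gridPoint a b N (κ + 1))) *
        ∫ x, (gridCell a b N κ).indicator (fun x => |w x|) x ∂Q := by
  have hi : ∀ (c : (Fin d → ℕ) → ℝ) {u : (Fin d → ℝ) → ℝ}, Integrable u Q → ∀ κ,
      Integrable (fun x => c κ * (gridCell a b N κ).indicator u x) Q := fun c u hu κ =>
    (hu.indicator (measurableSet_gridCell a b N κ)).const_mul _
  have e : ∀ (c : (Fin d → ℕ) → ℝ) {u : (Fin d → ℝ) → ℝ}, Integrable u Q →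
      ∑ κ ∈ gridIndex d N, c κ * ∫ x, (gridCell a b N κ).indicator u x ∂Q =
        ∫ x, ∑ κ ∈ gridIndex d N, c κ * (gridCell a b N κ).indicator u x ∂Q := by
    intro c u hu
    rw [integral_finsetSum _ fun κ _ => hi c hu κ]
    exact Finset.sum_congr rfl fun κ _ => (integral_const_mul _ _).symm
  rw [e _ hw, e (fun κ => f (gridPoint a b N κ) - f (gridPoint a b N (κ + 1))) hw.abs,
    ← integral_sub (integrable_mul_of_mem_shapeClass hQac hw hf)
      (integrable_finsetSum _ fun κ _ => hi (fun κ => f (gridPoint a b N κ)) hw κ)]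
  refine (abs_integral_le_integral_abs).trans (integral_mono_ae
    (((integrable_mul_of_mem_shapeClass hQac hw hf).sub
      (integrable_finsetSum _ fun κ _ => hi (fun κ => f (gridPoint a b N κ)) hw κ)).abs)
    (integrable_finsetSum _ fun κ _ =>
      hi (fun κ => f (gridPoint a b N κ) - f (gridPoint a b N (κ + 1))) hw.abs κ) ?_)
  filter_upwards [hQbox] with x hx
  exact abs_mul_sub_sum_gridCell_le hab hN (mem_shapeClass_iff.1 hf).2 w
    (fun j => (hx j).1) (fun j => (hx j).2)

/-- The deviations of the sample means of `w` and `|w|` over the cells of a grid. -/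
def gridDeviation (a b : Fin d → ℝ) (Q : Measure (Fin d → ℝ)) (X : ℕ → Ω → Fin d → ℝ)
    (w : (Fin d → ℝ) → ℝ) (N n : ℕ) (ω : Ω) : ℝ :=
  ∑ κ ∈ gridIndex d N,
    (|sampleMean X ((gridCell a b N κ).indicator w) n ω -
        ∫ x, (gridCell a b N κ).indicator w x ∂Q| +
      |sampleMean X ((gridCell a b N κ).indicator fun x => |w x|) n ω -
        ∫ x, (gridCell a b N κ).indicator (fun x => |w x|) x ∂Q|)

/-- Compare through the sample and population means of the step function. The sample oscillation is
itself replaced by the population one at the price of the deviations of `|w|`, whence the factor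
`2`. -/
theorem abs_sampleMean_sub_integral_le {a b : Fin d → ℝ} (hab : ∀ i, a i < b i) {M : ℝ}
    (hQac : Q ≪ volume.restrict (Set.Icc a b))
    (hQbox : ∀ᵐ x ∂Q, ∀ j, a j ≤ x j ∧ x j < b j) {N : ℕ} (hN : 0 < N)
    {f : (Fin d → ℝ) → ℝ} (hf : f ∈ shapeClass a b M) {w : (Fin d → ℝ) → ℝ}
    (hw : Integrable w Q) {ω : Ω} (hω : ∀ i j, a j ≤ X i ω j ∧ X i ω j < b j) (n : ℕ) :
    |sampleMean X (fun x => w x * f x) n ω - ∫ x, w x * f x ∂Q| ≤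
      M * gridDeviation a b Q X w N n ω +
        2 * ∑ κ ∈ gridIndex d N, (f (gridPoint a b N κ) - f (gridPoint a b N (κ + 1))) *
          ∫ x, (gridCell a b N κ).indicator (fun x => |w x|) x ∂Q := by
  have hanti := (mem_shapeClass_iff.1 hf).2
  have h1 := abs_sampleMean_sub_le hab hN hanti w hω n
  have h2 := abs_integral_sub_le hab hQac hQbox hN hf hw
  have hF : ∀ κ ∈ gridIndex d N, (0 ≤ f (gridPoint a b N κ) ∧ f (gridPoint a b N κ) ≤ M) ∧
      0 ≤ f (gridPoint a b N κ) - f (gridPoint a b N (κ + 1)) ∧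
      f (gridPoint a b N κ) - f (gridPoint a b N (κ + 1)) ≤ M := by
    intro κ hκ
    have m1 := gridPoint_mem_Icc hab hN fun i => (mem_gridIndex.1 hκ i).le
    have m2 := gridPoint_mem_Icc hab hN (κ := κ + 1) fun i => mem_gridIndex.1 hκ i
    have h3 := hanti m1 m2 (gridPoint_mono hab N (fun i => Nat.le_succ _))
    exact ⟨hf.1 _ m1, sub_nonneg.2 h3, by linarith [(hf.1 _ m1).2, (hf.1 _ m2).1]⟩
  have h3 : |∑ κ ∈ gridIndex d N, f (gridPoint a b N κ) *
        sampleMean X ((gridCell a b N κ).indicator w) n ω -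
      ∑ κ ∈ gridIndex d N, f (gridPoint a b N κ) *
        ∫ x, (gridCell a b N κ).indicator w x ∂Q| ≤
      ∑ κ ∈ gridIndex d N, M * |sampleMean X ((gridCell a b N κ).indicator w) n ω -
        ∫ x, (gridCell a b N κ).indicator w x ∂Q| := by
    rw [← Finset.sum_sub_distrib]
    refine (Finset.abs_sum_le_sum_abs _ _).trans (Finset.sum_le_sum fun κ hκ => ?_)
    rw [← mul_sub, abs_mul, abs_of_nonneg (hF κ hκ).1.1]
    gcongr
    exact (hF κ hκ).1.2
  have h4 : ∑ κ ∈ gridIndex d N, (f (gridPoint a b N κ) - f (gridPoint a b N (κ + 1))) *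
        sampleMean X ((gridCell a b N κ).indicator fun x => |w x|) n ω -
      ∑ κ ∈ gridIndex d N, (f (gridPoint a b N κ) - f (gridPoint a b N (κ + 1))) *
        ∫ x, (gridCell a b N κ).indicator (fun x => |w x|) x ∂Q ≤
      ∑ κ ∈ gridIndex d N, M *
        |sampleMean X ((gridCell a b N κ).indicator fun x => |w x|) n ω -
          ∫ x, (gridCell a b N κ).indicator (fun x => |w x|) x ∂Q| := by
    rw [← Finset.sum_sub_distrib]
    refine Finset.sum_le_sum fun κ hκ => ?_
    rw [← mul_sub]
    exact (mul_le_mul_of_nonneg_left (le_abs_self _) (hF κ hκ).2.1).trans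
      (mul_le_mul_of_nonneg_right (hF κ hκ).2.2 (abs_nonneg _))
  rw [gridDeviation, Finset.mul_sum]
  simp only [mul_add, Finset.sum_add_distrib]
  have h1 := abs_le.1 h1
  have h2 := abs_le.1 h2
  have h3 := abs_le.1 h3
  exact abs_le.2 ⟨by linarith [h1.1, h2.2, h3.1], by linarith [h1.2, h2.1, h3.2]⟩

theorem gridDeviation_nonneg (a b : Fin d → ℝ) (w : (Fin d → ℝ) → ℝ) (N n : ℕ) (ω : Ω) :
    0 ≤ gridDeviation a b Q X w N n ω :=
  Finset.sum_nonneg fun _ _ => add_nonneg (abs_nonneg _) (abs_nonneg _)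

variable [MeasurableSpace Ω] {P : Measure Ω}

theorem measurable_sampleMean (hX : ∀ i, Measurable (X i)) {w : (Fin d → ℝ) → ℝ}
    (hw : Measurable w) (n : ℕ) : Measurable (sampleMean X w n) :=
  (Finset.measurable_sum _ fun i _ => hw.comp (hX i)).const_mul _

theorem tendsto_sampleMean (hX : ∀ i, Measurable (X i)) (hindep : iIndepFun X P)
    (hlaw : ∀ i, P.map (X i) = Q) {w : (Fin d → ℝ) → ℝ} (hw : Measurable w)
    (hwi : Integrable w Q) :
    ∀ᵐ ω ∂P, Tendsto (fun n => sampleMean X w n ω) atTop (𝓝 (∫ x, w x ∂Q)) := by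
  have h := strong_law_ae_real (μ := P) (fun i ω => w (X i ω))
    ((integrable_map_measure (hw.aestronglyMeasurable) (hX 0).aemeasurable).1
      ((hlaw 0).symm ▸ hwi))
    (fun i j hij => (hindep.indepFun hij).comp hw hw)
    (fun i => (IdentDistrib.mk (hX i).aemeasurable (hX 0).aemeasurable
      ((hlaw i).trans (hlaw 0).symm)).comp hw)
  have hint : ∫ ω, w (X 0 ω) ∂P = ∫ x, w x ∂Q := by
    rw [← hlaw 0, integral_map (hX 0).aemeasurable hw.aestronglyMeasurable]
  filter_upwards [h] with ω hω
  rw [hint] at hω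
  refine hω.congr fun n => ?_
  rw [sampleMean, one_div, div_eq_inv_mul]

theorem ae_forall_sample (hX : ∀ i, Measurable (X i)) (hlaw : ∀ i, P.map (X i) = Q)
    {p : (Fin d → ℝ) → Prop} (hp : ∀ᵐ x ∂Q, p x) : ∀ᵐ ω ∂P, ∀ i, p (X i ω) :=
  ae_all_iff.2 fun i => ae_of_ae_map (hX i).aemeasurable ((hlaw i).symm ▸ hp)

theorem measurable_gridDeviation (a b : Fin d → ℝ) (hX : ∀ i, Measurable (X i))
    {w : (Fin d → ℝ) → ℝ} (hw : Measurable w) (N n : ℕ) :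
    Measurable (gridDeviation a b Q X w N n) := by
  refine Finset.measurable_sum _ fun κ _ => ?_
  have hm := measurableSet_gridCell a b N κ
  have h1 := measurable_sampleMean hX (hw.indicator hm) n
  have h2 := measurable_sampleMean hX (hw.abs.indicator hm) n
  exact (h1.sub_const _).abs.add (h2.sub_const _).abs

theorem tendsto_gridDeviation (a b : Fin d → ℝ) (hX : ∀ i, Measurable (X i))
    (hindep : iIndepFun X P) (hlaw : ∀ i, P.map (X i) = Q) {w : (Fin d → ℝ) → ℝ}
    (hw : Measurable w) (hwi : Integrable w Q) (N : ℕ) :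
    ∀ᵐ ω ∂P, Tendsto (fun n => gridDeviation a b Q X w N n ω) atTop (𝓝 0) := by
  have h : ∀ {u : (Fin d → ℝ) → ℝ}, Measurable u → Integrable u Q → ∀ᵐ ω ∂P,
      ∀ κ : Fin d → ℕ, Tendsto (fun n => |sampleMean X ((gridCell a b N κ).indicator u) n ω -
        ∫ x, (gridCell a b N κ).indicator u x ∂Q|) atTop (𝓝 0) := by
    intro u hu hui
    refine ae_all_iff.2 fun κ => ?_
    have hm := measurableSet_gridCell a b N κ
    filter_upwards [tendsto_sampleMean hX hindep hlaw (hu.indicator hm) (hui.indicator hm)] with ω hω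
    simpa using (hω.sub_const (∫ x, (gridCell a b N κ).indicator u x ∂Q)).abs
  filter_upwards [h hw hwi, h hw.abs hwi.abs] with ω h1 h2
  have := tendsto_finsetSum (gridIndex d N) fun κ _ => (h1 κ).add (h2 κ)
  simpa [gridDeviation] using this

/-- Uniform law of large numbers over the shape class: the deviations are bounded by measurable
maps that converge to zero almost surely. -/
theorem exists_uniform_deviation_bound {a b : Fin d → ℝ} (hab : ∀ i, a i < b i) {M : ℝ}
    [IsProbabilityMeasure P] (hM : 0 ≤ M) (hX : ∀ i, Measurable (X i))
    (hindep : iIndepFun X P)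
    (hlaw : ∀ i, P.map (X i) = Q) (hQac : Q ≪ volume.restrict (Set.Icc a b)) {C : ℝ} (hC : 0 ≤ C)
    (hQ : ∀ S, Q S ≤ ENNReal.ofReal C * volume S)
    (hQbox : ∀ᵐ x ∂Q, ∀ j, a j ≤ x j ∧ x j < b j) {w : (Fin d → ℝ) → ℝ} (hwi : Integrable w Q) :
    ∃ ε : ℕ → Ω → ℝ, (∀ n, Measurable (ε n)) ∧
      (∀ᵐ ω ∂P, Tendsto (fun n => ε n ω) atTop (𝓝 0)) ∧
      ∀ᵐ ω ∂P, ∀ n, ∀ f ∈ shapeClass a b M,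
        |sampleMean X (fun x => w x * f x) n ω - ∫ x, w x * f x ∂Q| ≤ ε n ω := by
  have : IsProbabilityMeasure Q := hlaw 0 ▸ Measure.isProbabilityMeasure_map (hX 0).aemeasurable
  -- A measurable version of `w` makes the bounds measurable; almost surely it agrees with `w` at
  -- all sample points.
  obtain ⟨v, hv, hwv⟩ : ∃ v, Measurable v ∧ w =ᵐ[Q] v :=
    ⟨hwi.1.mk w, hwi.1.stronglyMeasurable_mk.measurable, hwi.1.ae_eq_mk⟩
  have hvi : Integrable v Q := hwi.congr hwv
  choose N hN0 hN using fun j : ℕ => exists_sum_oscillation_le hab hM hC hQ hvi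
    (η := 1 / ((j : ℝ) + 1)) (by positivity)
  let e : ℕ → ℕ → Ω → ℝ := fun j n ω =>
    M * gridDeviation a b Q X v (N j) n ω + 2 * (1 / ((j : ℝ) + 1))
  have he0 : ∀ j n ω, 0 ≤ e j n ω := fun j n ω => by
    have := gridDeviation_nonneg (Q := Q) (X := X) a b v (N j) n ω
    positivity
  have hbdd : ∀ n ω, BddBelow (Set.range fun j => e j n ω) := fun n ω =>
    ⟨0, by rintro _ ⟨j, rfl⟩; exact he0 j n ω⟩
  -- Each mesh gives a bound with limit `2 / (j + 1)`. The countable infimum stays measurable and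
  -- tends to zero, with no need to couple the mesh to `n`.
  refine ⟨fun n ω => ⨅ j, e j n ω, fun n => Measurable.iInf fun j => ?_, ?_, ?_⟩
  · exact ((measurable_gridDeviation a b hX hv (N j) n).const_mul M).add_const _
  · filter_upwards [ae_all_iff.2 fun j => tendsto_gridDeviation a b hX hindep hlaw hv hvi (N j)]
      with ω hω
    refine tendsto_order.2 ⟨fun c hc => Eventually.of_forall fun n =>
      hc.trans_le (Real.iInf_nonneg fun j => he0 j n ω), fun c hc => ?_⟩
    have h1 : Tendsto (fun j : ℕ => 2 * (1 / ((j : ℝ) + 1))) atTop (𝓝 0) := by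
      simpa using (tendsto_one_div_add_atTop_nhds_zero_nat (𝕜 := ℝ)).const_mul 2
    obtain ⟨j, hj⟩ := (h1.eventually_lt_const hc).exists
    have h2 : Tendsto (fun n => e j n ω) atTop (𝓝 (M * 0 + 2 * (1 / ((j : ℝ) + 1)))) :=
      ((hω j).const_mul M).add_const _
    rw [mul_zero, zero_add] at h2
    filter_upwards [h2.eventually_lt_const hj] with n hn
    exact (ciInf_le (hbdd n ω) j).trans_lt hn
  · filter_upwards [ae_forall_sample hX hlaw hQbox, ae_forall_sample hX hlaw hwv] with ω h1 h2
    intro n f hf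
    have hanti := (mem_shapeClass_iff.1 hf).2
    have e1 : sampleMean X (fun x => w x * f x) n ω = sampleMean X (fun x => v x * f x) n ω := by
      simp only [sampleMean, h2]
    have e2 : ∫ x, w x * f x ∂Q = ∫ x, v x * f x ∂Q :=
      integral_congr_ae (by filter_upwards [hwv] with x hx; rw [hx])
    rw [e1, e2]
    refine le_ciInf fun j => (abs_sampleMean_sub_integral_le hab hQac hQbox (hN0 j) hf hvi h1 n).trans
      ?_
    have := hN j (fun κ => f (gridPoint a b (N j) κ))
      (fun κ hκ => hf.1 _ (gridPoint_mem_Icc hab (hN0 j) hκ))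
      (fun κ hκ => hanti (gridPoint_mem_Icc hab (hN0 j) fun i => (mem_gridIndex.1 hκ i).le)
        (gridPoint_mem_Icc hab (hN0 j) (κ := κ + 1) fun i => mem_gridIndex.1 hκ i)
        (gridPoint_mono hab _ fun i => Nat.le_succ _))
    simp only [e]
    linarith

end Sample

end IWSAA

end

noncomputable section

namespace IWSAA

/-! ### The sampling distribution and the moments -/

section Moments

variable {d : ℕ} {a b : Fin d → ℝ} {M : ℝ} {g φ : (Fin d → ℝ) → ℝ}

theorem densityLaw_absolutelyContinuous : densityLaw a b g ≪ volume.restrict (Set.Icc a b) :=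
  withDensity_absolutelyContinuous _ _

theorem densityLaw_le {C : ℝ} (hC : ∀ x ∈ Set.Icc a b, g x ≤ C) :
    densityLaw a b g ≤ ENNReal.ofReal C • volume.restrict (Set.Icc a b) := by
  rw [← withDensity_const, densityLaw]
  refine withDensity_mono ?_
  filter_upwards [ae_restrict_mem measurableSet_Icc] with x hx
  exact ENNReal.ofReal_le_ofReal (hC x hx)

theorem densityLaw_apply_le {C : ℝ} (hC : ∀ x ∈ Set.Icc a b, g x ≤ C) (S : Set (Fin d → ℝ)) :
    densityLaw a b g S ≤ ENNReal.ofReal C * volume S := by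
  refine (densityLaw_le hC S).trans ?_
  rw [Measure.smul_apply, smul_eq_mul]
  gcongr
  exact Measure.restrict_le_self

theorem ae_densityLaw_mem_Icc : ∀ᵐ x ∂(densityLaw a b g), x ∈ Set.Icc a b :=
  densityLaw_absolutelyContinuous.ae_le (ae_restrict_mem measurableSet_Icc)

/-- The half-open cells miss the upper faces of the box, which are null. -/
theorem ae_densityLaw_mem_Ico : ∀ᵐ x ∂(densityLaw a b g), ∀ j, a j ≤ x j ∧ x j < b j := by
  have h : (Set.pi Set.univ fun i => Set.Ico (a i) (b i)) =ᵐ[volume] Set.Icc a b :=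
    Measure.univ_pi_Ico_ae_eq_Icc
  have h' : ∀ᵐ x ∂(volume.restrict (Set.Icc a b)), ∀ j, a j ≤ x j ∧ x j < b j := by
    rw [ae_restrict_iff' measurableSet_Icc]
    filter_upwards [h.mem_iff] with x hx hx'
    exact fun j => hx.2 hx' j (Set.mem_univ j)
  exact densityLaw_absolutelyContinuous.ae_le h'

theorem integrable_div_density (hg : AEMeasurable g (volume.restrict (Set.Icc a b))) {c C : ℝ}
    (hc : 0 < c) (hcg : ∀ x ∈ Set.Icc a b, c ≤ g x) (hC : ∀ x ∈ Set.Icc a b, g x ≤ C)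
    (hφ : Integrable φ (volume.restrict (Set.Icc a b))) :
    Integrable (fun x => φ x / g x) (densityLaw a b g) := by
  have h1 : Integrable φ (densityLaw a b g) :=
    (hφ.smul_measure ENNReal.ofReal_ne_top).mono_measure (densityLaw_le hC)
  simp only [div_eq_mul_inv]
  refine h1.mul_bdd (c := c⁻¹)
    (hg.mono_ac densityLaw_absolutelyContinuous).inv.aestronglyMeasurable ?_
  filter_upwards [ae_densityLaw_mem_Icc] with x hx
  have := hcg x hx
  rw [Real.norm_of_nonneg (inv_nonneg.2 (hc.le.trans this))]
  gcongr

theorem popMoment_eq {f L : (Fin d → ℝ) → ℝ} (hL : ∀ x ∈ Set.Icc a b, L x = f x / g x) :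
    popMoment a b g φ L = ∫ x, φ x / g x * f x ∂(densityLaw a b g) := by
  refine integral_congr_ae ?_
  filter_upwards [ae_densityLaw_mem_Icc] with x hx
  rw [hL x hx]
  ring

theorem sampleMoment_eq {Ω : Type*} {X : ℕ → Ω → Fin d → ℝ} {ω : Ω}
    (hω : ∀ i, X i ω ∈ Set.Icc a b) {f L : (Fin d → ℝ) → ℝ}
    (hL : ∀ x ∈ Set.Icc a b, L x = f x / g x) (n : ℕ) :
    sampleMoment (fun i : Fin n => X i ω) φ (fun i => L (X i ω)) =
      sampleMean X (fun x => φ x / g x * f x) n ω := by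
  rw [sampleMoment, sampleMean, ← Fin.sum_univ_eq_sum_range fun i => φ (X i ω) / g (X i ω) * f (X i ω)]
  congr 1
  refine Finset.sum_congr rfl fun i _ => ?_
  rw [hL _ (hω i)]
  ring

theorem convex_ratioClass : Convex ℝ (ratioClass a b M g) := by
  rintro L ⟨f, hf, hL⟩ L' ⟨f', hf', hL'⟩ s t hs ht hst
  have hf := mem_shapeClass_iff.1 hf
  have hf' := mem_shapeClass_iff.1 hf'
  refine ⟨s • f + t • f', mem_shapeClass_iff.2 ⟨fun x hx => ⟨?_, ?_⟩, ?_⟩, fun x hx => ?_⟩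
  · have := (hf.1 x hx).1
    have := (hf'.1 x hx).1
    simp only [Pi.add_apply, Pi.smul_apply, smul_eq_mul]
    positivity
  · simp only [Pi.add_apply, Pi.smul_apply, smul_eq_mul]
    calc s * f x + t * f' x ≤ s * M + t * M := by
          gcongr
          · exact (hf.1 x hx).2
          · exact (hf'.1 x hx).2
      _ = M := by rw [← add_mul, hst, one_mul]
  · intro x hx y hy hxy
    have h1 := hf.2 hx hy hxy
    have h2 := hf'.2 hx hy hxy
    simp only [Pi.add_apply, Pi.smul_apply, smul_eq_mul]
    gcongr
  · simp only [Pi.add_apply, Pi.smul_apply, smul_eq_mul, hL x hx, hL' x hx]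
    ring

theorem integrable_mul_of_mem_ratioClass
    (hφ : Integrable (fun x => φ x / g x) (densityLaw a b g)) {L : (Fin d → ℝ) → ℝ}
    (hL : L ∈ ratioClass a b M g) : Integrable (fun x => φ x * L x) (densityLaw a b g) := by
  obtain ⟨f, hf, hL⟩ := hL
  refine (integrable_mul_of_mem_shapeClass densityLaw_absolutelyContinuous hφ hf).congr ?_
  filter_upwards [ae_densityLaw_mem_Icc] with x hx
  rw [hL x hx]
  ring

theorem popMoment_combo (hφ : Integrable (fun x => φ x / g x) (densityLaw a b g))
    {L L' : (Fin d → ℝ) → ℝ} (hL : L ∈ ratioClass a b M g) (hL' : L' ∈ ratioClass a b M g)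
    (s t : ℝ) :
    popMoment a b g φ (s • L + t • L') = s * popMoment a b g φ L + t * popMoment a b g φ L' := by
  rw [popMoment, popMoment, popMoment, ← integral_const_mul, ← integral_const_mul,
    ← integral_add ((integrable_mul_of_mem_ratioClass hφ hL).const_mul s)
      ((integrable_mul_of_mem_ratioClass hφ hL').const_mul t)]
  congr 1
  funext x
  simp only [Pi.add_apply, Pi.smul_apply, smul_eq_mul]
  ring

theorem sampleMoment_combo {n : ℕ} (x : Fin n → Fin d → ℝ) (L L' : (Fin d → ℝ) → ℝ) (s t : ℝ) :
    sampleMoment x φ (fun i => (s • L + t • L') (x i)) =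
      s * sampleMoment x φ (fun i => L (x i)) + t * sampleMoment x φ (fun i => L' (x i)) := by
  simp only [sampleMoment, Finset.mul_sum, ← Finset.sum_add_distrib, Pi.add_apply, Pi.smul_apply,
    smul_eq_mul]
  exact Finset.sum_congr rfl fun i _ => by ring

theorem abs_popMoment_le (hφ : Integrable (fun x => φ x / g x) (densityLaw a b g))
    {L : (Fin d → ℝ) → ℝ} (hL : L ∈ ratioClass a b M g) :
    |popMoment a b g φ L| ≤ (∫ x, |φ x / g x| ∂(densityLaw a b g)) * M := by
  obtain ⟨f, hf, hL⟩ := hL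
  rw [popMoment_eq hL, ← integral_mul_const]
  refine abs_integral_le_integral_abs.trans (integral_mono_ae
    (integrable_mul_of_mem_shapeClass densityLaw_absolutelyContinuous hφ hf).abs
    (hφ.abs.mul_const M) ?_)
  filter_upwards [ae_densityLaw_mem_Icc] with x hx
  simp only [abs_mul, abs_of_nonneg (hf.1 x hx).1]
  gcongr
  exact (hf.1 x hx).2

end Moments

/-! ### Consistency -/

/-- The objective, the inequality moments and the equality moments of a decision variable. -/
def momentPoint {α : Type*} {m k : ℕ} (p₀ : α → ℝ) (p : Fin m → α → ℝ) (q : Fin k → α → ℝ)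
    (L : α) : ℝ × (Fin m → ℝ) × (Fin k → ℝ) :=
  (p₀ L, fun j => p j L, fun j => q j L)

/-- Puts the population and the sample problem into the same finite-dimensional form, with
population or sample moments as `p₀`, `p`, `q`. -/
theorem optVal_momentFeasible_image {α : Type*} {m k : ℕ} (R : Set α) (p₀ : α → ℝ)
    (p : Fin m → α → ℝ) (q : Fin k → α → ℝ) (μ : Fin m → ℝ) (ν : Fin k → ℝ) :
    optVal (momentFeasible (momentPoint p₀ p q '' R) μ ν) Prod.fst =
      optVal {L | (∀ j, p j L ≤ μ j) ∧ (∀ j, q j L = ν j) ∧ L ∈ R} p₀ := by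
  have : momentFeasible (momentPoint p₀ p q '' R) μ ν =
      momentPoint p₀ p q '' {L | (∀ j, p j L ≤ μ j) ∧ (∀ j, q j L = ν j) ∧ L ∈ R} := by
    ext z
    constructor
    · rintro ⟨⟨L, hL, rfl⟩, h1, h2⟩
      exact ⟨L, ⟨h1, fun j => congrFun h2 j, hL⟩, rfl⟩
    · rintro ⟨L, ⟨h1, h2, hL⟩, rfl⟩
      exact ⟨⟨L, hL, rfl⟩, h1, funext h2⟩
  rw [this, optVal_image]
  rfl

theorem convex_image_momentPoint {α : Type*} [AddCommMonoid α] [Module ℝ α] {m k : ℕ} {R : Set α}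
    (hR : Convex ℝ R) {p₀ : α → ℝ} {p : Fin m → α → ℝ} {q : Fin k → α → ℝ}
    (h₀ : ∀ L ∈ R, ∀ L' ∈ R, ∀ s t : ℝ, p₀ (s • L + t • L') = s * p₀ L + t * p₀ L')
    (hp : ∀ j, ∀ L ∈ R, ∀ L' ∈ R, ∀ s t : ℝ, p j (s • L + t • L') = s * p j L + t * p j L')
    (hq : ∀ j, ∀ L ∈ R, ∀ L' ∈ R, ∀ s t : ℝ, q j (s • L + t • L') = s * q j L + t * q j L') :
    Convex ℝ (momentPoint p₀ p q '' R) := by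
  rintro _ ⟨L, hL, rfl⟩ _ ⟨L', hL', rfl⟩ s t hs ht hst
  refine ⟨s • L + t • L', hR hL hL' hs ht hst, ?_⟩
  refine Prod.ext (h₀ L hL L' hL' s t) (Prod.ext (funext fun j => ?_) (funext fun j => ?_))
  · exact hp j L hL L' hL' s t
  · exact hq j L hL L' hL' s t

theorem norm_momentPoint_sub_le {α : Type*} {m k : ℕ} {p₀ p₀' : α → ℝ} {p p' : Fin m → α → ℝ}
    {q q' : Fin k → α → ℝ} {L : α} {e₀ : ℝ} {e₁ : Fin m → ℝ} {e₂ : Fin k → ℝ}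
    (h₀ : |p₀ L - p₀' L| ≤ e₀) (h₁ : ∀ j, |p j L - p' j L| ≤ e₁ j)
    (h₂ : ∀ j, |q j L - q' j L| ≤ e₂ j) :
    ‖momentPoint p₀ p q L - momentPoint p₀' p' q' L‖ ≤ e₀ + ∑ j, e₁ j + ∑ j, e₂ j := by
  have n₀ : 0 ≤ e₀ := (abs_nonneg _).trans h₀
  have n₁ : ∀ j, 0 ≤ e₁ j := fun j => (abs_nonneg _).trans (h₁ j)
  have n₂ : ∀ j, 0 ≤ e₂ j := fun j => (abs_nonneg _).trans (h₂ j)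
  have s₁ : 0 ≤ ∑ j, e₁ j := Finset.sum_nonneg fun j _ => n₁ j
  have s₂ : 0 ≤ ∑ j, e₂ j := Finset.sum_nonneg fun j _ => n₂ j
  rw [Prod.norm_def, Prod.norm_def]
  refine max_le ?_ (max_le ?_ ?_)
  · exact (show ‖p₀ L - p₀' L‖ ≤ e₀ from h₀).trans (by linarith)
  · refine (pi_norm_le_iff_of_nonneg (by linarith)).2 fun j => ?_
    have := Finset.single_le_sum (fun i _ => n₁ i) (Finset.mem_univ j)
    exact (show ‖p j L - p' j L‖ ≤ e₁ j from h₁ j).trans (by linarith)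
  · refine (pi_norm_le_iff_of_nonneg (by linarith)).2 fun j => ?_
    have := Finset.single_le_sum (fun i _ => n₂ i) (Finset.mem_univ j)
    exact (show ‖q j L - q' j L‖ ≤ e₂ j from h₂ j).trans (by linarith)

theorem exists_sampleMoment_deviation_bound {d : ℕ} {a b : Fin d → ℝ} (hab : ∀ i, a i < b i)
    {M : ℝ} (hM : 0 ≤ M) {g φ : (Fin d → ℝ) → ℝ} {C : ℝ} (hC0 : 0 ≤ C)
    (hC : ∀ x ∈ Set.Icc a b, g x ≤ C)
    (hφ : Integrable (fun x => φ x / g x) (densityLaw a b g))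
    {Ω : Type*} [MeasurableSpace Ω] {P : Measure Ω} [IsProbabilityMeasure P]
    {X : ℕ → Ω → Fin d → ℝ} (hX : ∀ i, Measurable (X i)) (hindep : iIndepFun X P)
    (hlaw : ∀ i, P.map (X i) = densityLaw a b g) :
    ∃ ε : ℕ → Ω → ℝ, (∀ n, Measurable (ε n)) ∧
      (∀ᵐ ω ∂P, Tendsto (fun n => ε n ω) atTop (𝓝 0)) ∧
      ∀ᵐ ω ∂P, ∀ n, ∀ L ∈ ratioClass a b M g,
        |popMoment a b g φ L -
          sampleMoment (fun i : Fin n => X i ω) φ (fun i => L (X i ω))| ≤ ε n ω := by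
  obtain ⟨ε, h1, h2, h3⟩ := exists_uniform_deviation_bound hab hM hX hindep hlaw
    densityLaw_absolutelyContinuous hC0 (densityLaw_apply_le hC) ae_densityLaw_mem_Ico hφ
  refine ⟨ε, h1, h2, ?_⟩
  filter_upwards [h3, ae_forall_sample hX hlaw ae_densityLaw_mem_Icc] with ω hω hbox
  rintro n L ⟨f, hf, hL⟩
  rw [popMoment_eq hL, sampleMoment_eq hbox hL, abs_sub_comm]
  exact hω n f hf

theorem tendstoOuterAS_saaVal {d m k : ℕ} {a b : Fin d → ℝ} (hab : ∀ i, a i < b i) {M : ℝ}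
    (hM : 0 ≤ M) {g φ₀ : (Fin d → ℝ) → ℝ} {C : ℝ} (hC0 : 0 ≤ C)
    (hC : ∀ x ∈ Set.Icc a b, g x ≤ C) {φ : Fin m → (Fin d → ℝ) → ℝ} {μ : Fin m → ℝ}
    {ψ : Fin k → (Fin d → ℝ) → ℝ} {ν : Fin k → ℝ}
    (hφ₀ : Integrable (fun x => φ₀ x / g x) (densityLaw a b g))
    (hφ : ∀ j, Integrable (fun x => φ j x / g x) (densityLaw a b g))
    (hψ : ∀ j, Integrable (fun x => ψ j x / g x) (densityLaw a b g))
    (hslater : SlaterCondition a b M g φ μ ψ ν)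
    {Ω : Type*} [MeasurableSpace Ω] {P : Measure Ω} [IsProbabilityMeasure P]
    {X : ℕ → Ω → Fin d → ℝ} (hX : ∀ i, Measurable (X i)) (hindep : iIndepFun X P)
    (hlaw : ∀ i, P.map (X i) = densityLaw a b g) :
    TendstoOuterAS P (fun n ω => saaVal a b M g φ₀ φ μ ψ ν (fun i : Fin n => X i ω))
      (fun _ => popVal a b M g φ₀ φ μ ψ ν) := by
  set T := momentPoint (popMoment a b g φ₀) (fun j => popMoment a b g (φ j))
    (fun j => popMoment a b g (ψ j)) with hT
  set S : ℕ → Ω → ((Fin d → ℝ) → ℝ) → ℝ × (Fin m → ℝ) × (Fin k → ℝ) := fun n ω =>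
    momentPoint (fun L => sampleMoment (fun i : Fin n => X i ω) φ₀ (fun i => L (X i ω)))
      (fun j L => sampleMoment (fun i : Fin n => X i ω) (φ j) (fun i => L (X i ω)))
      (fun j L => sampleMoment (fun i : Fin n => X i ω) (ψ j) (fun i => L (X i ω))) with hS
  set R := ratioClass a b M g
  have hconvT : Convex ℝ (T '' R) := convex_image_momentPoint convex_ratioClass
    (fun L hL L' hL' s t => popMoment_combo hφ₀ hL hL' s t)
    (fun j L hL L' hL' s t => popMoment_combo (hφ j) hL hL' s t)
    (fun j L hL L' hL' s t => popMoment_combo (hψ j) hL hL' s t)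
  have hconvS : ∀ n ω, Convex ℝ (S n ω '' R) := fun n ω =>
    convex_image_momentPoint convex_ratioClass
      (fun L _ L' _ s t => sampleMoment_combo _ L L' s t)
      (fun j L _ L' _ s t => sampleMoment_combo _ L L' s t)
      (fun j L _ L' _ s t => sampleMoment_combo _ L L' s t)
  obtain ⟨B, hB⟩ : ∃ B, ∀ z ∈ T '' R, |z.1| ≤ B :=
    ⟨_, by rintro _ ⟨L, hL, rfl⟩; exact abs_popMoment_le hφ₀ hL⟩
  have hB' : ∀ z ∈ T '' R, ∀ j, |z.2.1 j| ≤
      ∑ j, (∫ x, |φ j x / g x| ∂(densityLaw a b g)) * M := by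
    rintro _ ⟨L, hL, rfl⟩ j
    exact (abs_popMoment_le (hφ j) hL).trans (Finset.single_le_sum
      (f := fun j => (∫ x, |φ j x / g x| ∂(densityLaw a b g)) * M)
      (fun i _ => mul_nonneg (integral_nonneg fun x => abs_nonneg _) hM) (Finset.mem_univ j))
  obtain ⟨ρ', hρ', hball⟩ : ∃ ρ > 0, Metric.ball (μ, ν) ρ ⊆ attainable (T '' R) := by
    obtain ⟨⟨L₀, hL₀, h1, h2⟩, hint⟩ := hslater
    refine exists_ball_subset_attainable hconvT hB' ⟨T L₀, ⟨L₀, hL₀, rfl⟩, h1, funext h2⟩ ?_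
    rw [Set.image_image]
    exact hint
  obtain ⟨ρ, hρ, rfl⟩ : ∃ ρ > 0, ρ' = 3 * ρ := ⟨ρ' / 3, by positivity, by ring⟩
  obtain ⟨e₀, m₀, t₀, b₀⟩ :=
    exists_sampleMoment_deviation_bound hab hM hC0 hC hφ₀ hX hindep hlaw
  choose e₁ m₁ t₁ b₁ using fun j =>
    exists_sampleMoment_deviation_bound hab hM hC0 hC (hφ j) hX hindep hlaw
  choose e₂ m₂ t₂ b₂ using fun j =>
    exists_sampleMoment_deviation_bound hab hM hC0 hC (hψ j) hX hindep hlaw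
  -- The last term only makes `ε` strictly positive, as the stability estimate requires.
  let ε : ℕ → Ω → ℝ := fun n ω =>
    |e₀ n ω| + ∑ j, |e₁ j n ω| + ∑ j, |e₂ j n ω| + 1 / ((n : ℝ) + 1)
  have hεm : ∀ n, Measurable (ε n) := fun n =>
    (((m₀ n).abs.add (Finset.measurable_sum _ fun j _ => (m₁ j n).abs)).add
      (Finset.measurable_sum _ fun j _ => (m₂ j n).abs)).add_const _
  have hε0 : ∀ n ω, 0 < ε n ω := fun n ω => by positivity
  have hεt : ∀ᵐ ω ∂P, Tendsto (fun n => ε n ω) atTop (𝓝 0) := by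
    filter_upwards [t₀, ae_all_iff.2 t₁, ae_all_iff.2 t₂] with ω h0 h1 h2
    have := ((h0.abs.add (tendsto_finsetSum Finset.univ fun j _ => (h1 j).abs)).add
      (tendsto_finsetSum Finset.univ fun j _ => (h2 j).abs)).add
      (tendsto_one_div_add_atTop_nhds_zero_nat (𝕜 := ℝ))
    simpa [ε] using this
  have hdev : ∀ᵐ ω ∂P, ∀ n, ∀ L ∈ R, ‖T L - S n ω L‖ ≤ ε n ω := by
    filter_upwards [b₀, ae_all_iff.2 b₁, ae_all_iff.2 b₂] with ω h0 h1 h2 n L hL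
    have h := norm_momentPoint_sub_le (p₀ := popMoment a b g φ₀)
      (p := fun j => popMoment a b g (φ j)) (q := fun j => popMoment a b g (ψ j))
      (p₀' := fun L => sampleMoment (fun i : Fin n => X i ω) φ₀ (fun i => L (X i ω)))
      (p' := fun j L => sampleMoment (fun i : Fin n => X i ω) (φ j) (fun i => L (X i ω)))
      (q' := fun j L => sampleMoment (fun i : Fin n => X i ω) (ψ j) (fun i => L (X i ω)))
      ((h0 n L hL).trans (le_abs_self _)) (fun j => (h1 j n L hL).trans (le_abs_self _))
      (fun j => (h2 j n L hL).trans (le_abs_self _))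
    refine h.trans (le_add_of_nonneg_right ?_)
    positivity
  set D : ℝ := 1 + 2 * (B + ρ) / ρ
  classical
  refine tendstoOuterAS_of_le
    -- While `ε` is at least `ρ` the stability estimate does not apply and the sample problem may be
    -- infeasible, so the bound is infinite. Almost surely this happens for finitely many `n` only.
    (fun n ω => if ε n ω < ρ then ENNReal.ofReal (D * ε n ω) else ⊤) (fun n => ?_)
    (Eventually.of_forall fun n => ?_) ?_
  · exact Measurable.ite (measurableSet_lt (hεm n) measurable_const)
      ((hεm n).const_mul D).ennreal_ofReal measurable_const
  · filter_upwards [hdev] with ω hω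
    split_ifs with hlt
    · have h := abs_optVal_sub_le hconvT (hconvS n ω) hB (hε0 n ω) hlt hball
        (by rintro _ ⟨L, hL, rfl⟩; exact ⟨_, ⟨L, hL, rfl⟩, hω n L hL⟩)
        (by rintro _ ⟨L, hL, rfl⟩; exact ⟨_, ⟨L, hL, rfl⟩, (norm_sub_rev _ _).trans_le (hω n L hL)⟩)
      rwa [hT, hS, optVal_momentFeasible_image, optVal_momentFeasible_image] at h
    · exact le_top
  · filter_upwards [hεt] with ω hω
    have h1 : Tendsto (fun n => ENNReal.ofReal (D * ε n ω)) atTop (𝓝 0) := by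
      simpa using ENNReal.tendsto_ofReal (hω.const_mul D)
    refine h1.congr' ?_
    filter_upwards [hω.eventually_lt_const hρ] with n hn
    rw [if_pos hn]

end IWSAA

end

/-! ### The corollary -/

theorem corollary2
    {d m k : ℕ} (hd : 2 ≤ d)
    (a b : Fin d → ℝ) (hab : ∀ i, a i < b i)
    (M : ℝ) (hM : 0 < M)
    -- the sampling density
    (g : (Fin d → ℝ) → ℝ)
    (hg_meas : AEMeasurable g (volume.restrict (Set.Icc a b)))
    (hg_lower : ∃ c : ℝ, 0 < c ∧ ∀ x ∈ Set.Icc a b, c ≤ g x)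
    (hg_upper : ∃ C : ℝ, ∀ x ∈ Set.Icc a b, g x ≤ C)
    (hg_mass : ∫ x in Set.Icc a b, g x = 1)
    -- the objective, the inequality constraints and the equality constraints
    (φ₀ : (Fin d → ℝ) → ℝ)
    (φ : Fin m → (Fin d → ℝ) → ℝ) (μ : Fin m → ℝ)
    (ψ : Fin k → (Fin d → ℝ) → ℝ) (ν : Fin k → ℝ)
    (δ : ℝ) (hδ : 0 < δ)
    (hφ₀ : MemLp φ₀ (ENNReal.ofReal (1 + δ)) (volume.restrict (Set.Icc a b)))
    (hφ : ∀ j, MemLp (φ j) (ENNReal.ofReal (1 + δ)) (volume.restrict (Set.Icc a b)))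
    (hψ : ∀ j, MemLp (ψ j) (ENNReal.ofReal (1 + δ)) (volume.restrict (Set.Icc a b)))
    (hslater : IWSAA.SlaterCondition a b M g φ μ ψ ν)
    -- the i.i.d. sample
    {Ω : Type*} [MeasurableSpace Ω] (P : Measure Ω) [IsProbabilityMeasure P]
    (X : ℕ → Ω → Fin d → ℝ) (hX_meas : ∀ i, Measurable (X i))
    (hX_indep : iIndepFun X P)
    (hX_law : ∀ i, P.map (X i) = IWSAA.densityLaw a b g) :
    -- equivalence with the linear program, at any sample points of the box
    (∀ (n : ℕ), 0 < n → ∀ x : Fin n → Fin d → ℝ, (∀ i, x i ∈ Set.Icc a b) →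
      (fun (L : (Fin d → ℝ) → ℝ) (i : Fin n) => L (x i)) '' IWSAA.ratioClass a b M g
          = IWSAA.discreteShape M g x ∧
      (fun (L : (Fin d → ℝ) → ℝ) (i : Fin n) => L (x i)) '' IWSAA.saaFeasible a b M g φ μ ψ ν x
          = IWSAA.lpFeasible M g φ μ ψ ν x ∧
      IWSAA.saaVal a b M g φ₀ φ μ ψ ν x = IWSAA.lpVal M g φ₀ φ μ ψ ν x ∧
      IWSAA.IsLinearProgram (IWSAA.lpFeasible M g φ μ ψ ν x)
        (fun y => IWSAA.sampleMoment x φ₀ y)) ∧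
    -- the sample points lie in the box almost surely
    (∀ᵐ ω ∂P, ∀ i, X i ω ∈ Set.Icc a b) ∧
    -- consistency
    IWSAA.TendstoOuterAS P
      (fun n ω => IWSAA.saaVal a b M g φ₀ φ μ ψ ν (fun i : Fin n => X i ω))
      (fun _ => IWSAA.popVal a b M g φ₀ φ μ ψ ν) := by
  obtain ⟨c, hc, hcg⟩ := hg_lower
  obtain ⟨C, hC⟩ := hg_upper
  have hgpos : ∀ x ∈ Set.Icc a b, 0 < g x := fun x hx => hc.trans_le (hcg x hx)
  have hC0 : 0 ≤ C := by
    have ha : a ∈ Set.Icc a b := ⟨le_rfl, fun i => (hab i).le⟩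
    exact (hgpos a ha).le.trans (hC a ha)
  have hint : ∀ {θ : (Fin d → ℝ) → ℝ},
      MemLp θ (ENNReal.ofReal (1 + δ)) (volume.restrict (Set.Icc a b)) →
      Integrable (fun x => θ x / g x) (IWSAA.densityLaw a b g) := fun {θ} hθ => by
    -- On a set of finite measure the `1 + δ` moment gives integrability, which is all that the law
    -- of large numbers needs.
    have : IsFiniteMeasure (volume.restrict (Set.Icc a b)) :=
      ⟨by simpa using isCompact_Icc.measure_lt_top⟩
    exact IWSAA.integrable_div_density hg_meas hc hcg hC
      (hθ.integrable (by rw [← ENNReal.ofReal_one]; exact ENNReal.ofReal_le_ofReal (by linarith)))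
  refine ⟨fun n hn x hx => ⟨?_, ?_, ?_, ?_⟩, ?_, ?_⟩
  · exact IWSAA.image_ratioClass hn hM.le hgpos x hx
  · exact IWSAA.image_saaFeasible hn hM.le hgpos φ μ ψ ν x hx
  · exact IWSAA.saaVal_eq_lpVal hn hM.le hgpos φ₀ φ μ ψ ν x hx
  · exact IWSAA.isLinearProgram_lpFeasible M g φ₀ φ μ ψ ν x
  · exact IWSAA.ae_forall_sample hX_meas hX_law IWSAA.ae_densityLaw_mem_Icc
  · exact IWSAA.tendstoOuterAS_saaVal hab hM.le hC0 hC (hint hφ₀) (fun j => hint (hφ j))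
      (fun j => hint (hψ j)) hslater hX_meas hX_indep hX_law
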